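/- Fix integers $d\ge 1$ and $r\ge d-1$, a rational number $b>1$, and a function $f:[0,1]\to\mathbb{R}$ of class $C^\infty$. Let $\mathbb{N}_b$ be the set of positive integers $n$ for which $nb$ is an even integer. For $n\in\mathbb{N}_b$ put $h=1/n$, $x_j=jh$ (for all integers $j$), $N=nb$ and $C=nb-n-1$, and define the modified FC-Gram interpolant $\tau_n(f)=t_{n,C}(f)$ as follows. Gram polynomials. Put $\langle p,q\rangle_L=\sum_{j=0}^{d-1}p(x_j)q(x_j)$ and $\langle p,q\rangle_R=\sum_{j=0}^{d-1}p(x_{n-j})q(x_{n-j})$. The left Gram polynomials $p_0^L,\dots,p_{d-1}^L$ are obtained by Gram–Schmidt orthonormalization of $1,x,\dots,x^{d-1}$ with respect to $\langle\cdot,\cdot\rangle_L$, and the right ones are $p_\ell^R(x)=p_\ell^L(x-1+(d-1)h)$. Hermite continuation. For $0\le m\le r$ let $$p_m^{u_1,u_2}(u)=\frac{(u-u_1)^m}{m!}\left(\frac{u-u_2}{u_1-u_2}\right)^{r+1}\sum_{k=0}^{r-m}\binom{r+k}{r}\left(\frac{u-u_1}{u_2-u_1}\right)^{k},$$ $$p_\ell^{L,e}(x)=\sum_{m=0}^{\ell}(p_\ell^L)^{(m)}(0)\,p_m^{b,1}(x),\qquad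 p_\ell^{R,e}(x)=\sum_{m=0}^{\ell}(p_\ell^R)^{(m)}(1)\,p_m^{1,b}(x),$$ and extend $f$ to $[1,b]$ by $$p(x)=\sum_{\ell=0}^{d-1}\langle f,p_\ell^L\rangle_L\,p_\ell^{L,e}(x)+\sum_{\ell=0}^{d-1}\langle f,p_\ell^R\rangle_R\,p_\ell^{R,e}(x).$$ Interpolation. Put $f_j^c=f(x_j)$ for $0\le j\le n$ and $f_j^c=p(x_j)$ for $n<j\le N-1$, and let $$\tau_n(f)(x)=\sum_{j=0}^{N-1}f_j^c\,L_j(x),\qquad L_j(x)=\frac1N\left(\frac{\sin\left(\pi(N-1)(j-nx)/N\right)}{\sin\left(\pi(j-nx)/N\right)}+\cos\left(\pi(j-nx)\right)\right),$$ where $L_j(x)=1$ if $x-x_j\in b\mathbb{Z}$. Then there is a constant $M>0$, independent of $n$, such that $$\|\tau_n(f)-f\|_{\infty,[0,1]}\le M\,n^{-d}\qquad\text{for all } n\in\mathbb{N}_b.$$ (For the finitely many $n<d-1$, the inner products involve nodes outside $[0,1]$; there $f$ is understood to be given arbitrary fixed values.) -/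

import Mathlib

open Polynomial

noncomputable section

namespace FCGram

/-- The admissible numbers of subintervals for the period `b`: positive integers `n` such that
`n * b` is an even natural number. -/
def admissible (b : ℚ) : Set ℕ :=
  {n : ℕ | 0 < n ∧ ∃ k : ℕ, (n : ℚ) * b = (k : ℚ) ∧ 2 ∣ k}

/-- The grid point `x_j = j h`, `h = 1 / n`. -/
def node (n j : ℕ) : ℝ := (j : ℝ) / (n : ℝ)

/-- The bilinear form `⟨p, q⟩_L` on the `d` leftmost grid points `x_0, …, x_{d-1}`. -/
def innerL (n d : ℕ) (p q : ℝ → ℝ) : ℝ :=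
  ∑ j ∈ Finset.range d, p (node n j) * q (node n j)

/-- The bilinear form `⟨p, q⟩_R` on the `d` rightmost grid points `x_n, …, x_{n-d+1}`
of `[0, 1]`; here `x_{n-j} = (n - j) / n`, with the subtraction in `ℝ`. -/
def innerR (n d : ℕ) (p q : ℝ → ℝ) : ℝ :=
  ∑ j ∈ Finset.range d, p (((n : ℝ) - (j : ℝ)) / (n : ℝ)) * q (((n : ℝ) - (j : ℝ)) / (n : ℝ))

/-- The left Gram polynomials `p_ℓ^L`: the Gram–Schmidt orthonormalization of `1, x, x², …`
with respect to `⟨·, ·⟩_L` (used for `ℓ < d`). -/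
def gramL (n d : ℕ) : ℕ → ℝ[X]
  | l =>
    let q : ℝ[X] := X ^ l - ∑ k : Fin l,
      C (innerL n d (fun x => x ^ l) (fun x => (gramL n d k.1).eval x)) * gramL n d k.1
    C (Real.sqrt (innerL n d (fun x => q.eval x) (fun x => q.eval x)))⁻¹ * q
  termination_by l => l
  decreasing_by all_goals exact k.2

/-- The right Gram polynomials `p_ℓ^R(x) = p_ℓ^L(x - 1 + (d - 1) h)`. -/
def gramR (n d l : ℕ) : ℝ[X] :=
  (gramL n d l).comp (X - C 1 + C (((d : ℝ) - 1) / (n : ℝ)))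

/-- The two-point Hermite polynomial `p_m^{u₁, u₂}` of parameter `r` (for `m ≤ r`): its derivatives
of orders `k ≤ r` are `δ_{k m}` at `u₁` and `0` at `u₂`. -/
def hermite (r m : ℕ) (u₁ u₂ u : ℝ) : ℝ :=
  1 / (m.factorial : ℝ) * (u - u₁) ^ m * ((u - u₂) / (u₁ - u₂)) ^ (r + 1) *
    ∑ l ∈ Finset.range (r - m + 1), ((r + l).choose r : ℝ) * ((u - u₁) / (u₂ - u₁)) ^ l

/-- The continuation `p_ℓ^{L,e}` of the left Gram polynomial `p_ℓ^L`. -/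
def extL (r : ℕ) (b : ℝ) (n d l : ℕ) (x : ℝ) : ℝ :=
  ∑ m ∈ Finset.range (l + 1), (derivative^[m] (gramL n d l)).eval 0 * hermite r m b 1 x

/-- The continuation `p_ℓ^{R,e}` of the right Gram polynomial `p_ℓ^R`. -/
def extR (r : ℕ) (b : ℝ) (n d l : ℕ) (x : ℝ) : ℝ :=
  ∑ m ∈ Finset.range (l + 1), (derivative^[m] (gramR n d l)).eval 1 * hermite r m 1 b x

/-- The extension `p` of `f` to `[1, b]`. -/
def extension (r : ℕ) (b : ℝ) (n d : ℕ) (f : ℝ → ℝ) (x : ℝ) : ℝ :=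
  (∑ l ∈ Finset.range d, innerL n d f (fun y => (gramL n d l).eval y) * extL r b n d l x) +
    ∑ l ∈ Finset.range d, innerR n d f (fun y => (gramR n d l).eval y) * extR r b n d l x

/-- The continued function on one period `[0, b]`: `f` on `[0, 1]` and `p` on `(1, b]`. -/
def continued (r : ℕ) (b : ℝ) (n d : ℕ) (f : ℝ → ℝ) (x : ℝ) : ℝ :=
  if x ≤ 1 then f x else extension r b n d f x

/-- The trigonometric cardinal function `L_j` on the `n + c + 1` nodes `x_0, …, x_{n+c}`
of one period (`n + c` odd). The sine in the denominator vanishes exactly when `x` is `x_j` modulo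
the period `(n + c + 1) / n`, where the value is `1`. -/
def cardinal (n c j : ℕ) (x : ℝ) : ℝ :=
  let t : ℝ := Real.pi * ((j : ℝ) - (n : ℝ) * x)
  let N : ℝ := (n : ℝ) + (c : ℝ) + 1
  if Real.sin (t / N) = 0 then 1
  else 1 / N * (Real.sin (t * ((n : ℝ) + (c : ℝ)) / N) / Real.sin (t / N) + Real.cos t)

/-- The FC-Gram interpolant `t_{n,c}(f)` with the Hermite continuations of the Gram polynomials;
the period is `b = 1 + (c + 1) h`. -/
def interpolant (r d n c : ℕ) (f : ℝ → ℝ) (x : ℝ) : ℝ :=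
  ∑ j ∈ Finset.range (n + c + 1),
    continued r (1 + ((c : ℝ) + 1) / (n : ℝ)) n d f (node n j) * cardinal n c j x

/-- `τ_n(f) = t_{n, n b - n - 1}(f)`. For `b > 1` and admissible `n`, `n * b` is an integer that
exceeds `n`, so the floor and the subtractions are exact. -/
def tau (r d : ℕ) (b : ℚ) (n : ℕ) (f : ℝ → ℝ) : ℝ → ℝ :=
  interpolant r d n (⌊(n : ℚ) * b⌋₊ - n - 1) f

end FCGram

end

open Polynomial

noncomputable section

namespace FCGram

/-! The continued function is smooth on `[0, 1]` and on `[1, b]`, so the regularity of its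
`b`-periodic extension is decided by the jumps of its derivatives at `1` and at `0 ≡ b`. There are
as many Gram polynomials as nodes, so each Gram expansion is the polynomial of degree `< d`
interpolating `f` at `d` end nodes (`expansionL_eval_node`, `expansionR_eval_node`). Its `m`-th
derivative at the end point differs from that of `f` by `O(h^(d-m))` for `m < d`
(`exists_expansion_jet_bound`). Since `d - 1 ≤ r`, the Hermite continuation transfers these
derivatives exactly to `b` and to `1`. The jump of order `m < d` is thus `O(h^(d-m))`, the jump of
order `d` is bounded, and the jump of order `0` vanishes because `0` and `1` are nodes.

Integrating by parts `d + 1` times bounds the Fourier coefficient `c_k`, `k ≠ 0`, by a constant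
times the sum of `h^(d-m) |k|^(-m-1)` over `1 ≤ m ≤ d`. For `|k| ≥ M = N/2`, which is of order
`1/h`, this is `O(h^(d-1) / k^2)`. Trigonometric interpolation reproduces the frequencies below `M`,
and each other one costs at most `2 |c_k|` (`abs_interpolation_sub_le`). The tail of `1/k^2` is
`O(1/M)`, which supplies the last factor `h`. The finitely many `n < d` are absorbed in the
constant. -/

/-! ### Trigonometric cardinal functions and discrete orthogonality -/

theorem sin_mul_sum_cos (M : ℕ) (θ : ℝ) :
    Real.sin θ * ∑ l ∈ Finset.range (2 * M), Real.cos (2 * ((l : ℝ) - M) * θ) =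
      Real.sin (2 * M * θ) * Real.cos θ := by
  have h : ∀ l : ℕ, Real.sin θ * Real.cos (2 * ((l : ℝ) - M) * θ) =
      Real.sin ((2 * (((l + 1 : ℕ) : ℝ) - M) - 1) * θ) / 2 -
        Real.sin ((2 * ((l : ℝ) - M) - 1) * θ) / 2 := by
    intro l
    have h1 : (2 * (((l + 1 : ℕ) : ℝ) - M) - 1) * θ = 2 * ((l : ℝ) - M) * θ + θ := by
      push_cast; ring
    have h2 : (2 * ((l : ℝ) - M) - 1) * θ = 2 * ((l : ℝ) - M) * θ - θ := by ring
    rw [h1, h2, Real.sin_add, Real.sin_sub]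
    ring
  rw [Finset.mul_sum, Finset.sum_congr rfl fun l _ => h l,
    Finset.sum_range_sub (fun l : ℕ => Real.sin ((2 * ((l : ℝ) - M) - 1) * θ) / 2)]
  have h1 : (2 * (((2 * M : ℕ) : ℝ) - M) - 1) * θ = 2 * M * θ - θ := by push_cast; ring
  have h2 : (2 * (((0 : ℕ) : ℝ) - M) - 1) * θ = -(2 * M * θ + θ) := by push_cast; ring
  rw [h1, h2, Real.sin_neg, Real.sin_add, Real.sin_sub]
  ring

/-- A Dirichlet kernel with frequencies `-M, …, M - 1`. The division disappears, so the exceptional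
value `1` needs no separate treatment afterwards. -/
theorem cardinal_eq_sum {n c M : ℕ} (hN : n + c + 1 = 2 * M) (j : ℕ) (x : ℝ) :
    cardinal n c j x = 1 / (2 * M : ℝ) * ∑ l ∈ Finset.range (2 * M),
      Real.cos (2 * ((l : ℝ) - M) * (Real.pi * ((j : ℝ) - n * x) / (2 * M))) := by
  have hM : (0 : ℝ) < M := by
    have : 0 < M := by omega
    exact_mod_cast this
  have hN' : (n : ℝ) + c + 1 = 2 * M := by exact_mod_cast hN
  unfold cardinal
  simp only [hN']
  set t : ℝ := Real.pi * ((j : ℝ) - n * x) with ht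
  split_ifs with h0
  · obtain ⟨q, hq⟩ := Real.sin_eq_zero_iff.1 h0
    rw [← hq, Finset.sum_congr rfl (g := fun _ => (1 : ℝ))]
    · simp
      field_simp
    · intro l _
      have : 2 * ((l : ℝ) - M) * (q * Real.pi) =
          (((l : ℤ) - (M : ℤ)) * q : ℤ) * (2 * Real.pi) := by push_cast; ring
      rw [this, Real.cos_int_mul_two_pi]
  · have h1 : t * ((n : ℝ) + c) / (2 * M) = 2 * M * (t / (2 * M)) - t / (2 * M) := by
      rw [show (n : ℝ) + c = 2 * M - 1 by linarith]
      field_simp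
    have h2 : Real.cos t = Real.cos (2 * M * (t / (2 * M))) := by
      congr 1; field_simp
    rw [h1, h2]
    congr 1
    have h3 := sin_mul_sum_cos M (t / (2 * M))
    rw [eq_comm, ← mul_right_inj' h0, h3, mul_add, mul_div_cancel₀ _ h0, Real.sin_sub]
    ring

theorem abs_cardinal_le_one {n c M : ℕ} (hN : n + c + 1 = 2 * M) (j : ℕ) (x : ℝ) :
    |cardinal n c j x| ≤ 1 := by
  have hM : (0 : ℝ) < M := by
    have : 0 < M := by omega
    exact_mod_cast this
  rw [cardinal_eq_sum hN, abs_mul, abs_of_pos (by positivity)]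
  have : |∑ l ∈ Finset.range (2 * M),
      Real.cos (2 * ((l : ℝ) - M) * (Real.pi * ((j : ℝ) - n * x) / (2 * M)))| ≤ 2 * M := by
    refine (Finset.abs_sum_le_sum_abs _ _).trans ?_
    refine (Finset.sum_le_sum fun l _ => Real.abs_cos_le_one _).trans ?_
    simp
  calc _ ≤ 1 / (2 * M : ℝ) * (2 * M) := by gcongr
    _ = 1 := by field_simp

theorem sum_exp_eq {N : ℕ} (hN : 0 < N) (z : ℤ) :
    ∑ j ∈ Finset.range N, Complex.exp (2 * Real.pi * Complex.I * z * j / N) =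
      if (N : ℤ) ∣ z then (N : ℂ) else 0 := by
  have hN' : (N : ℂ) ≠ 0 := by exact_mod_cast hN.ne'
  set ζ : ℂ := Complex.exp (2 * Real.pi * Complex.I * z / N) with hζ
  have hpow : ∀ j : ℕ, Complex.exp (2 * Real.pi * Complex.I * z * j / N) = ζ ^ j := by
    intro j
    rw [hζ, ← Complex.exp_nat_mul]
    congr 1; ring
  simp_rw [hpow]
  have hone : ζ = 1 ↔ (N : ℤ) ∣ z := by
    rw [hζ, Complex.exp_eq_one_iff]
    constructor
    · rintro ⟨q, hq⟩
      refine ⟨q, ?_⟩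
      have h2 : (2 * Real.pi * Complex.I : ℂ) ≠ 0 := Complex.two_pi_I_ne_zero
      have : (2 * Real.pi * Complex.I) * (z : ℂ) = (2 * Real.pi * Complex.I) * ((N : ℂ) * q) := by
        field_simp at hq
        linear_combination (2 * Real.pi * Complex.I) * hq
      exact_mod_cast mul_left_cancel₀ h2 this
    · rintro ⟨q, rfl⟩
      refine ⟨q, ?_⟩
      push_cast
      field_simp
  split_ifs with h
  · simp [hone.2 h]
  · have h1 : ζ - 1 ≠ 0 := sub_ne_zero.2 fun h' => h (hone.1 h')
    have h2 : ζ ^ N = 1 := by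
      rw [← hpow, Complex.exp_eq_one_iff]
      exact ⟨z, by field_simp⟩
    have h3 := mul_geom_sum ζ N
    rw [h2, sub_self] at h3
    exact (mul_eq_zero.1 h3).resolve_left h1

theorem sum_ite_dvd {N : ℕ} (hN : 0 < N) (z : ℤ) (F : ℤ → ℂ) :
    ∑ l ∈ Finset.range N, (if (N : ℤ) ∣ (l : ℤ) - z then (N : ℂ) else 0) * F l =
      N * F (z % N) := by
  have hN' : (N : ℤ) ≠ 0 := by exact_mod_cast hN.ne'
  have h0 := Int.emod_nonneg z hN'
  have h1 := Int.emod_lt_of_pos z (by exact_mod_cast hN : (0 : ℤ) < N)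
  have hmod := Int.emod_add_mul_ediv z N
  rw [Finset.sum_eq_single (z % N).toNat]
  · rw [Int.toNat_of_nonneg h0, if_pos]
    exact ⟨-(z / N), by linarith⟩
  · intro l hl hne
    rw [if_neg, zero_mul]
    intro hd
    apply hne
    have h2 : (N : ℤ) ∣ (l : ℤ) - z % N := by
      have : (l : ℤ) - z % N = (l - z) + N * (z / N) := by linarith
      rw [this]
      exact dvd_add hd (dvd_mul_right _ _)
    have h3 : |(l : ℤ) - z % N| < N := by
      have := Finset.mem_range.1 hl
      rw [abs_lt]; constructor <;> omega
    have := Int.eq_zero_of_abs_lt_dvd h2 h3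
    omega
  · intro h
    exfalso; apply h
    rw [Finset.mem_range]; omega

/-- Trigonometric interpolation of an exponential yields the mean of two exponentials; it
reproduces the frequencies below the Nyquist frequency. -/
theorem sum_exp_mul_cardinal {n c M : ℕ} (hN : n + c + 1 = 2 * M) (k : ℤ) (x : ℝ) :
    ∃ k₁ k₂ : ℤ, (∑ j ∈ Finset.range (n + c + 1),
        Complex.exp (2 * Real.pi * Complex.I * k * j / (2 * M)) * (cardinal n c j x : ℂ) =
      (Complex.exp (2 * Real.pi * Complex.I * k₁ * (n * x) / (2 * M)) +
        Complex.exp (2 * Real.pi * Complex.I * k₂ * (n * x) / (2 * M))) / 2) ∧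
      (|k| < M → k₁ = k ∧ k₂ = k) := by
  have hM : 0 < M := by omega
  have hM' : (M : ℂ) ≠ 0 := by exact_mod_cast hM.ne'
  set F : ℤ → ℂ := fun l => Complex.exp (2 * Real.pi * Complex.I * (M - l) * (n * x) / (2 * M))
    with hF
  set G : ℤ → ℂ := fun l => Complex.exp (2 * Real.pi * Complex.I * (l - M) * (n * x) / (2 * M))
    with hG
  -- Each cosine is half a sum of two exponentials. Orthogonality over the nodes keeps only `l ≡ M -
  -- k` in one family and `l ≡ M + k` in the other, so `k₁` and `k₂` are the representatives of `k`
  -- modulo `2M` in `(-M, M]` and in `[-M, M)`.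
  refine ⟨M - (M - k) % (2 * M : ℕ), (M + k) % (2 * M : ℕ) - M, ?_, ?_⟩
  · rw [hN]
    have hterm : ∀ j : ℕ, Complex.exp (2 * Real.pi * Complex.I * k * j / (2 * M)) *
        (cardinal n c j x : ℂ) = 1 / (4 * M : ℂ) * ∑ l ∈ Finset.range (2 * M),
          (Complex.exp (2 * Real.pi * Complex.I * ((l : ℤ) - (M - k) : ℤ) * j / (2 * M : ℕ)) * F l +
            Complex.exp (2 * Real.pi * Complex.I * (M + k - (l : ℤ) : ℤ) * j / (2 * M : ℕ))
              * G l) := by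
      intro j
      rw [cardinal_eq_sum hN]
      push_cast
      rw [mul_left_comm, Finset.mul_sum, Finset.mul_sum, Finset.mul_sum]
      refine Finset.sum_congr rfl fun l _ => ?_
      rw [Complex.cos, hF, hG]
      simp only [← Complex.exp_add]
      have e1 : (2 * Real.pi * Complex.I * (l - (M - k)) * j / (2 * M) +
          2 * Real.pi * Complex.I * (M - (l : ℤ)) * (n * x) / (2 * M) : ℂ) =
          2 * Real.pi * Complex.I * k * j / (2 * M) +
          2 * (l - M) * (Real.pi * (j - n * x) / (2 * M)) * Complex.I := by
        push_cast; field_simp; ring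
      have e2 : (2 * Real.pi * Complex.I * (M + k - l) * j / (2 * M) +
          2 * Real.pi * Complex.I * ((l : ℤ) - M) * (n * x) / (2 * M) : ℂ) =
          2 * Real.pi * Complex.I * k * j / (2 * M) +
          -(2 * (l - M) * (Real.pi * (j - n * x) / (2 * M))) * Complex.I := by
        push_cast; field_simp; ring
      rw [e1, e2, Complex.exp_add, Complex.exp_add]
      field_simp
      ring
    rw [Finset.sum_congr rfl fun j _ => hterm j, ← Finset.mul_sum, Finset.sum_comm]
    simp_rw [Finset.sum_add_distrib, ← Finset.sum_mul]
    simp_rw [sum_exp_eq (show 0 < 2 * M by omega)]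
    rw [sum_ite_dvd (by omega)]
    have hflip : ∀ l : ℕ, (((2 * M : ℕ) : ℤ) ∣ (M + k - (l : ℤ))) =
        (((2 * M : ℕ) : ℤ) ∣ ((l : ℤ) - (M + k))) := by
      intro l
      rw [← dvd_neg, neg_sub]
    simp_rw [hflip]
    rw [sum_ite_dvd (by omega)]
    simp only [hF, hG]
    push_cast
    field_simp
    ring
  · intro hk
    rw [abs_lt] at hk
    rw [Int.emod_eq_of_lt (by omega) (by push_cast; omega),
      Int.emod_eq_of_lt (by omega) (by push_cast; omega)]
    omega

/-! ### Fourier integrals of piecewise smooth functions -/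

/-- Repeated integration by parts. The derivatives are taken within the interval, so one-sided
smoothness at the end points suffices. -/
theorem integral_exp_mul_eq {a c : ℝ} (hac : a ≤ c) {g : ℕ → ℝ → ℝ}
    (hg : ∀ m, ∀ x ∈ Set.Icc a c, HasDerivWithinAt (g m) (g (m + 1) x) (Set.Icc a c) x)
    {w : ℂ} (hw : w ≠ 0) (K : ℕ) :
    ∫ x in a..c, Complex.exp (w * x) * (g 0 x : ℂ) =
      ∑ m ∈ Finset.range K, (-1) ^ m / w ^ (m + 1) *
        (Complex.exp (w * c) * g m c - Complex.exp (w * a) * g m a) +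
      (-1) ^ K / w ^ K * ∫ x in a..c, Complex.exp (w * x) * (g K x : ℂ) := by
  have hcont : ∀ m, ContinuousOn (fun x => (g m x : ℂ)) (Set.uIcc a c) := by
    intro m
    rw [Set.uIcc_of_le hac]
    exact Complex.continuous_ofReal.comp_continuousOn
      fun x hx => (hg m x hx).continuousWithinAt
  have step : ∀ m, ∫ x in a..c, Complex.exp (w * x) * (g m x : ℂ) =
      1 / w * (Complex.exp (w * c) * g m c - Complex.exp (w * a) * g m a) -
        1 / w * ∫ x in a..c, Complex.exp (w * x) * (g (m + 1) x : ℂ) := by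
    intro m
    have h := intervalIntegral.integral_mul_deriv_eq_deriv_mul_of_hasDerivWithinAt
      (a := a) (b := c) (u := fun x => (g m x : ℂ)) (u' := fun x => (g (m + 1) x : ℂ))
      (v := fun x => Complex.exp (w * x) / w) (v' := fun x => Complex.exp (w * x)) ?_ ?_
      (hcont (m + 1)).intervalIntegrable
      (Continuous.intervalIntegrable (by fun_prop) _ _)
    · have e1 : ∫ x in a..c, Complex.exp (w * x) * (g m x : ℂ) =
          ∫ x in a..c, (g m x : ℂ) * Complex.exp (w * x) := by simp_rw [mul_comm]
      have e2 : ∫ x in a..c, (g (m + 1) x : ℂ) * (Complex.exp (w * x) / w) =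
          1 / w * ∫ x in a..c, Complex.exp (w * x) * (g (m + 1) x : ℂ) := by
        rw [← intervalIntegral.integral_const_mul]
        congr 1; ext x; ring
      rw [e1, h, e2]
      ring
    · intro x hx
      rw [Set.uIcc_of_le hac] at hx ⊢
      exact (hg m x hx).ofReal_comp
    · intro x _
      have h1 : HasDerivAt (fun x : ℝ => w * (x : ℂ)) w x := by
        simpa using (Complex.ofRealCLM.hasDerivAt (x := x)).const_mul w
      have h2 := (h1.cexp).div_const w
      rw [mul_div_cancel_right₀ _ hw] at h2
      exact h2.hasDerivWithinAt
  induction K with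
  | zero => simp
  | succ K ih =>
    rw [ih, step K, Finset.sum_range_succ]
    field_simp
    ring

theorem norm_integral_exp_mul_le {a c : ℝ} (hac : a ≤ c) {g : ℝ → ℝ} {w : ℂ} (hw : w.re = 0)
    {A : ℝ} (hA : ∀ x ∈ Set.Icc a c, |g x| ≤ A) :
    ‖∫ x in a..c, Complex.exp (w * x) * (g x : ℂ)‖ ≤ A * (c - a) := by
  have h := intervalIntegral.norm_integral_le_of_norm_le_const (a := a) (b := c) (C := A)
    (f := fun x => Complex.exp (w * x) * (g x : ℂ)) ?_
  · rwa [abs_of_nonneg (sub_nonneg.2 hac)] at h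
  · intro x hx
    rw [Set.uIoc_of_le hac] at hx
    rw [norm_mul, Complex.norm_exp, Complex.norm_real]
    simpa [hw] using hA x ⟨hx.1.le, hx.2⟩

/-- The Fourier integral of a function that is smooth on `[0, 1]` and on `[1, b]` is controlled by
the jumps of its derivatives. -/
theorem norm_integral_piecewise_le {b : ℝ} (hb : 1 < b) {u v : ℕ → ℝ → ℝ}
    (hu : ∀ m, ∀ x ∈ Set.Icc (0 : ℝ) 1,
      HasDerivWithinAt (u m) (u (m + 1) x) (Set.Icc 0 1) x)
    (hv : ∀ m, ∀ x ∈ Set.Icc (1 : ℝ) b,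
      HasDerivWithinAt (v m) (v (m + 1) x) (Set.Icc 1 b) x)
    {w : ℂ} (hw : w ≠ 0) (hre : w.re = 0) (hper : Complex.exp (w * b) = 1) (K : ℕ) {A : ℝ}
    (hAu : ∀ x ∈ Set.Icc (0 : ℝ) 1, |u K x| ≤ A) (hAv : ∀ x ∈ Set.Icc (1 : ℝ) b, |v K x| ≤ A) :
    ‖(∫ x in (0 : ℝ)..1, Complex.exp (w * x) * (u 0 x : ℂ)) +
        ∫ x in (1 : ℝ)..b, Complex.exp (w * x) * (v 0 x : ℂ)‖ ≤
      ∑ m ∈ Finset.range K, (|v m b - u m 0| + |u m 1 - v m 1|) / ‖w‖ ^ (m + 1) +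
        A * b / ‖w‖ ^ K := by
  rw [integral_exp_mul_eq zero_le_one hu hw K, integral_exp_mul_eq hb.le hv hw K]
  set I := ∫ x in (0 : ℝ)..1, Complex.exp (w * x) * (u K x : ℂ)
  set J := ∫ x in (1 : ℝ)..b, Complex.exp (w * x) * (v K x : ℂ)
  have hI : ‖I‖ ≤ A * (1 - 0) := norm_integral_exp_mul_le zero_le_one hre hAu
  have hJ : ‖J‖ ≤ A * (b - 1) := norm_integral_exp_mul_le hb.le hre hAv
  have hsplit : ∀ S T : ℂ, S + (-1) ^ K / w ^ K * I + (T + (-1) ^ K / w ^ K * J) =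
      (S + T) + (-1) ^ K / w ^ K * (I + J) := by intros; ring
  rw [hsplit, ← Finset.sum_add_distrib]
  refine (norm_add_le _ _).trans (add_le_add ((norm_sum_le _ _).trans ?_) ?_)
  · refine Finset.sum_le_sum fun m _ => ?_
    rw [← mul_add, norm_mul, norm_div, norm_pow, norm_neg, norm_one, one_pow, norm_pow,
      div_mul_eq_mul_div, one_mul]
    gcongr
    -- By periodicity of the exponential the boundary terms at `0` and `b` merge into one jump, and
    -- the two at `1` into another.
    have e : Complex.exp (w * (1 : ℝ)) * (u m 1 : ℂ) - Complex.exp (w * (0 : ℝ)) * (u m 0 : ℂ) +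
        (Complex.exp (w * b) * (v m b : ℂ) - Complex.exp (w * (1 : ℝ)) * (v m 1 : ℂ)) =
        ((v m b - u m 0 : ℝ) : ℂ) + Complex.exp (w * (1 : ℝ)) * ((u m 1 - v m 1 : ℝ) : ℂ) := by
      rw [hper]; push_cast; simp; ring
    rw [e]
    refine (norm_add_le _ _).trans ?_
    rw [norm_mul, Complex.norm_exp, Complex.norm_real, Complex.norm_real]
    simp [hre]
  · rw [norm_mul, norm_div, norm_pow, norm_neg, norm_one, one_pow, norm_pow,
      div_mul_eq_mul_div, one_mul]
    gcongr
    have := norm_add_le I J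
    linarith

/-! ### Aliasing -/

theorem exists_hasSum_inv_sq_le {M : ℕ} (hM : 0 < M) :
    ∃ S : ℝ, S ≤ 4 / M ∧
      HasSum (fun k : ℤ => if (M : ℤ) ≤ |k| then 1 / (k : ℝ) ^ 2 else 0) S := by
  set g : ℕ → ℝ := fun k => if M ≤ k then 1 / (k : ℝ) ^ 2 else 0 with hg
  have hnn : ∀ k, 0 ≤ g k := fun k => by
    rw [hg]; dsimp only; split_ifs <;> positivity
  have hle : ∀ R, ∑ k ∈ Finset.range R, g k ≤ 2 / M := by
    intro R
    have h1 := sum_Ioo_inv_sq_le (α := ℝ) (M - 1) R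
    rw [Nat.cast_sub hM, Nat.cast_one, sub_add_cancel] at h1
    refine le_trans (le_of_eq ?_) h1
    rw [hg, ← Finset.sum_filter]
    refine Finset.sum_congr ?_ fun k _ => by rw [one_div]
    ext k
    simp only [Finset.mem_filter, Finset.mem_range, Finset.mem_Ioo]
    omega
  have hs : HasSum g (∑' k, g k) := (summable_of_sum_range_le hnn hle).hasSum
  have ht := Real.tsum_le_of_sum_range_le hnn hle
  refine ⟨_, ?_, HasSum.of_nat_of_neg (g := ∑' k, g k) (g' := ∑' k, g k) ?_ ?_⟩
  · have h0 : ¬ ((M : ℤ) ≤ |0|) := by simp; omega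
    rw [if_neg h0]
    calc _ ≤ 2 / (M : ℝ) + 2 / M - 0 := by gcongr
      _ = 4 / M := by ring
  · rwa [show (fun k : ℕ => if (M : ℤ) ≤ |(k : ℤ)| then 1 / (((k : ℤ) : ℝ)) ^ 2 else 0) = g by
      ext k; simp [hg]]
  · rwa [show (fun k : ℕ => if (M : ℤ) ≤ |-(k : ℤ)| then 1 / (((-(k : ℤ) : ℤ) : ℝ)) ^ 2 else 0) = g by
      ext k; simp [hg]]

/-- Aliasing: the error of trigonometric interpolation is bounded by twice the sum of the moduli of
the Fourier coefficients from the Nyquist frequency on. -/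
theorem abs_interpolation_sub_le {n c M : ℕ} (hn : 0 < n) (hN : n + c + 1 = 2 * M) {b : ℝ}
    (hb : (n : ℝ) * b = 2 * M) {F : ℝ → ℝ} {cf : ℤ → ℂ} {x : ℝ}
    (hx : HasSum (fun k => cf k * Complex.exp (2 * Real.pi * Complex.I * k * x / b)) (F x : ℂ))
    (hnode : ∀ j < n + c + 1, HasSum
      (fun k => cf k * Complex.exp (2 * Real.pi * Complex.I * k * (node n j : ℝ) / b))
      (F (node n j) : ℂ))
    {ε : ℝ} (hε : ∀ k : ℤ, (M : ℤ) ≤ |k| → ‖cf k‖ ≤ ε * (1 / (k : ℝ) ^ 2)) :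
    |∑ j ∈ Finset.range (n + c + 1), F (node n j) * cardinal n c j x - F x| ≤ 2 * ε * (4 / M) := by
  have hM : 0 < M := by omega
  have hn' : (n : ℂ) ≠ 0 := by exact_mod_cast hn.ne'
  have hM' : (M : ℂ) ≠ 0 := by exact_mod_cast hM.ne'
  have hb' : (b : ℂ) = 2 * M / n := by
    rw [eq_div_iff hn', mul_comm]; exact_mod_cast hb
  have hε0 : 0 ≤ ε := by
    have h := (norm_nonneg _).trans (hε M (le_abs_self _))
    by_contra hneg
    have : ε * (1 / ((M : ℤ) : ℝ) ^ 2) < 0 :=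
      mul_neg_of_neg_of_pos (not_le.1 hneg) (by push_cast; positivity)
    linarith
  -- Interpolation is a finite linear combination of nodal values, so it acts on the Fourier series
  -- term by term.
  have hS := (hasSum_sum fun j hj => (hnode j (Finset.mem_range.1 hj)).mul_right
    (cardinal n c j x : ℂ)).sub hx
  obtain ⟨S, hS4, hsumS⟩ := exists_hasSum_inv_sq_le hM
  have hmain := HasSum.norm_le_of_bounded hS (hsumS.mul_left (2 * ε)) (fun k => ?_)
  · rw [← Real.norm_eq_abs, ← Complex.norm_real]
    push_cast
    refine hmain.trans ?_
    gcongr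
  · obtain ⟨k₁, k₂, hk, hk'⟩ := sum_exp_mul_cardinal hN k x
    have e1 : ∑ j ∈ Finset.range (n + c + 1), cf k *
        Complex.exp (2 * Real.pi * Complex.I * k * (node n j : ℝ) / b) * (cardinal n c j x : ℂ) =
        cf k * ∑ j ∈ Finset.range (n + c + 1),
          Complex.exp (2 * Real.pi * Complex.I * k * j / (2 * M)) * (cardinal n c j x : ℂ) := by
      rw [Finset.mul_sum]
      refine Finset.sum_congr rfl fun j _ => ?_
      rw [mul_assoc]
      congr 3
      rw [hb', node]
      push_cast
      field_simp
    have e2 : (2 * Real.pi * Complex.I * k * x / b : ℂ) =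
        2 * Real.pi * Complex.I * k * (n * x) / (2 * M) := by
      rw [hb']; field_simp
    have hnorm : ∀ q : ℤ, ‖Complex.exp (2 * Real.pi * Complex.I * q * (n * x) / (2 * M))‖ = 1 := by
      intro q
      have : (2 * Real.pi * Complex.I * q * (n * x) / (2 * M) : ℂ) =
          ((2 * Real.pi * q * (n * x) / (2 * M) : ℝ) : ℂ) * Complex.I := by
        push_cast; ring
      rw [this, Complex.norm_exp_ofReal_mul_I]
    rw [e1, hk, e2, ← mul_sub, norm_mul]
    split_ifs with hkM
    -- The factor `2` bounds the distance from a mean of two unimodular numbers to a third one.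
    · rw [show 2 * ε * (1 / (k : ℝ) ^ 2) = ε * (1 / (k : ℝ) ^ 2) * 2 by ring]
      refine mul_le_mul (hε k hkM) ?_ (norm_nonneg _) (by positivity)
      refine (norm_sub_le _ _).trans ?_
      rw [norm_div, hnorm]
      have := norm_add_le (Complex.exp (2 * Real.pi * Complex.I * k₁ * (n * x) / (2 * M)))
        (Complex.exp (2 * Real.pi * Complex.I * k₂ * (n * x) / (2 * M)))
      rw [hnorm, hnorm] at this
      rw [Complex.norm_ofNat]
      linarith
    · obtain ⟨rfl, h2⟩ := hk' (not_le.1 hkM)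
      rw [h2, add_self_div_two, sub_self, norm_zero]
      simp

/-! ### Pointwise convergence of the Fourier series -/

theorem continuousOn_piecewise {b : ℝ} (hb : 1 < b) {u v : ℝ → ℝ}
    (hu : ContinuousOn u (Set.Icc 0 1)) (hv : ContinuousOn v (Set.Icc 1 b)) (h1 : u 1 = v 1) :
    ContinuousOn (fun x => if x ≤ 1 then u x else v x) (Set.Icc 0 b) := by
  have hunion : Set.Icc (0 : ℝ) b = Set.Icc 0 1 ∪ Set.Icc 1 b :=
    (Set.Icc_union_Icc_eq_Icc zero_le_one hb.le).symm
  rw [hunion]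
  refine ContinuousOn.union_of_isClosed ?_ ?_ isClosed_Icc isClosed_Icc
  · exact hu.congr fun x hx => if_pos hx.2
  · refine hv.congr fun x hx => ?_
    split_ifs with h
    · rw [le_antisymm h hx.1, h1]
    · rfl

/-- The matching conditions at `1` and at the ends of the period make the glued function descend to
a continuous function on the circle, whose Fourier series converges pointwise once its coefficients
are summable. -/
theorem hasSum_fourier_piecewise {b : ℝ} (hb : 1 < b) {u v : ℝ → ℝ}
    (hu : ContinuousOn u (Set.Icc 0 1)) (hv : ContinuousOn v (Set.Icc 1 b)) (h1 : u 1 = v 1)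
    (hb0 : v b = u 0) {cf : ℤ → ℂ}
    (hcf : ∀ k : ℤ, cf k = 1 / b *
      ((∫ x in (0 : ℝ)..1, Complex.exp (-(2 * Real.pi * Complex.I * k / b) * x) * (u x : ℂ)) +
        ∫ x in (1 : ℝ)..b, Complex.exp (-(2 * Real.pi * Complex.I * k / b) * x) * (v x : ℂ)))
    (hs : Summable cf) {x : ℝ} (hx : x ∈ Set.Ico 0 b) :
    HasSum (fun k => cf k * Complex.exp (2 * Real.pi * Complex.I * k * x / b))
      ((if x ≤ 1 then u x else v x : ℝ) : ℂ) := by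
  have : Fact (0 < b) := ⟨by linarith⟩
  set F : ℝ → ℂ := fun x => ((if x ≤ 1 then u x else v x : ℝ) : ℂ) with hF
  have hcont : ContinuousOn F (Set.Icc 0 b) :=
    Complex.continuous_ofReal.comp_continuousOn (continuousOn_piecewise hb hu hv h1)
  have hper : F 0 = F b := by
    simp [hF, not_le.2 hb, hb0]
  set G : C(AddCircle b, ℂ) := ⟨AddCircle.liftIco b 0 F,
    AddCircle.liftIco_zero_continuous hper hcont⟩ with hG
  have hcoef : fourierCoeff G = cf := by
    ext k
    have e0 : fourierCoeff G k = fourierCoeff (AddCircle.liftIco b 0 F) k := rfl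
    have hb1 : IntervalIntegrable
        (fun x => Complex.exp (-(2 * Real.pi * Complex.I * k / b) * x) * F x)
        MeasureTheory.volume 0 b := by
      apply ContinuousOn.intervalIntegrable
      rw [Set.uIcc_of_le (by linarith)]
      exact ContinuousOn.mul (by fun_prop) hcont
    rw [e0, fourierCoeff_liftIco_eq, fourierCoeffOn_eq_integral, hcf]
    have e1 : ∀ x : ℝ, (fourier (-k) (x : AddCircle (0 + b - 0)) : ℂ) =
        Complex.exp (-(2 * Real.pi * Complex.I * k / b) * x) := by
      intro x
      rw [fourier_coe_apply]
      congr 1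
      push_cast
      rw [zero_add, sub_zero]
      ring
    simp_rw [e1]
    rw [zero_add, sub_zero, Complex.real_smul]
    push_cast
    simp only [smul_eq_mul]
    congr 1
    rw [← intervalIntegral.integral_add_adjacent_intervals (b := 1)
      (hb1.mono_set ?_) (hb1.mono_set ?_)]
    · congr 1
      · refine intervalIntegral.integral_congr fun x hx => ?_
        rw [Set.uIcc_of_le zero_le_one] at hx
        simp [hF, hx.2]
      · refine intervalIntegral.integral_congr fun x hx => ?_
        rw [Set.uIcc_of_le hb.le] at hx
        change _ * ((if x ≤ 1 then u x else v x : ℝ) : ℂ) = _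
        split_ifs with h
        · rw [le_antisymm h hx.1, h1]
        · rfl
    · rw [Set.uIcc_of_le zero_le_one, Set.uIcc_of_le (by linarith)]
      exact Set.Icc_subset_Icc_right hb.le
    · rw [Set.uIcc_of_le hb.le, Set.uIcc_of_le (by linarith)]
      exact Set.Icc_subset_Icc_left zero_le_one
  have h := has_pointwise_sum_fourier_series_of_summable (f := G) (by rwa [hcoef]) (x : AddCircle b)
  rw [hcoef] at h
  have e2 : G (x : AddCircle b) = F x := by
    change AddCircle.liftIco b 0 F (x : AddCircle b) = F x
    exact AddCircle.liftIco_zero_coe_apply hx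
  rw [e2] at h
  simpa only [smul_eq_mul, fourier_coe_apply] using h

/-! ### Interpolation error from the sizes of the jumps -/

/-- Used with `q = 1 / |k|`: two factors `q` are kept for summability over `k`, and the other `d -
1` factors are replaced by `s`. For `m = 0` there is only one factor `q`, which is why the jump of
order `0` has to vanish. -/
theorem pow_mul_pow_le_of_le {q h s : ℝ} (hq : 0 ≤ q) (hh : 0 ≤ h) (hqs : q ≤ s) (hhs : h ≤ s)
    {m d : ℕ} (hm : 1 ≤ m) (hmd : m ≤ d) : q ^ (m + 1) * h ^ (d - m) ≤ s ^ (d - 1) * q ^ 2 := by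
  obtain ⟨m, rfl⟩ := Nat.exists_eq_add_of_le' hm
  obtain ⟨e, rfl⟩ := Nat.exists_eq_add_of_le hmd
  have hs : 0 ≤ s := hq.trans hqs
  rw [show m + 1 + e - (m + 1) = e by omega, show m + 1 + e - 1 = m + e by omega,
    show q ^ (m + 1 + 1) * h ^ e = (q ^ m * h ^ e) * q ^ 2 by ring, pow_add]
  gcongr

/-- Trigonometric interpolation of a continuous periodic function that is smooth on `[0, 1]` and on
`[1, b]` and whose derivatives of order `m` jump by `O(n ^ (m - d))` converges with order `d`. -/
theorem exists_interpolation_bound {b : ℝ} (hb : 1 < b) {d : ℕ} (hd : 1 ≤ d) :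
    ∃ C : ℝ, 0 < C ∧ ∀ n c M : ℕ, 0 < n → n + c + 1 = 2 * M → (n : ℝ) * b = 2 * M →
      ∀ u v : ℕ → ℝ → ℝ,
      (∀ m, ∀ x ∈ Set.Icc (0 : ℝ) 1,
        HasDerivWithinAt (u m) (u (m + 1) x) (Set.Icc 0 1) x) →
      (∀ m, ∀ x ∈ Set.Icc (1 : ℝ) b,
        HasDerivWithinAt (v m) (v (m + 1) x) (Set.Icc 1 b) x) →
      u 0 1 = v 0 1 → v 0 b = u 0 0 → ∀ A : ℝ,
      (∀ m ≤ d, |v m b - u m 0| ≤ A * (1 / (n : ℝ)) ^ (d - m)) →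
      (∀ m ≤ d, |u m 1 - v m 1| ≤ A * (1 / (n : ℝ)) ^ (d - m)) →
      (∀ x ∈ Set.Icc (0 : ℝ) 1, |u (d + 1) x| ≤ A) →
      (∀ x ∈ Set.Icc (1 : ℝ) b, |v (d + 1) x| ≤ A) →
      ∀ x ∈ Set.Icc (0 : ℝ) 1,
        |∑ j ∈ Finset.range (n + c + 1),
          (if node n j ≤ 1 then u 0 (node n j) else v 0 (node n j)) * cardinal n c j x - u 0 x| ≤
        C * A * (1 / (n : ℝ)) ^ d := by
  have hb0 : 0 < b := by linarith
  set β : ℝ := b / (2 * Real.pi) with hβ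
  have hβ0 : 0 < β := by positivity
  set B : ℝ := (1 + β) ^ (d + 1) with hB
  set D : ℝ := 1 / b * ((d + 1) * (2 * B) + b * B) with hD
  have hB0 : 0 < B := by positivity
  have hD0 : 0 < D := by positivity
  -- The aliasing bound gives `8 = 2 * 4`; the choice `s = 2 * h` gives `2 ^ (d - 1)`, and `1 / M ≤
  -- 2 * h` one more `2`. In `D`, the `d + 1` orders carry two jumps each and `b * B` comes from the
  -- remainder integral.
  refine ⟨8 * D * 2 ^ d, by positivity, ?_⟩
  intro n c M hn hN hnb u v hu hv huv1 hvu0 A hJ0 hJ1 hAu hAv x hx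
  have hM : 0 < M := by omega
  have hn1 : (1 : ℝ) ≤ n := by exact_mod_cast hn
  have hA : 0 ≤ A := (abs_nonneg _).trans (hAu 0 (by simp))
  set h : ℝ := 1 / (n : ℝ) with hh
  have hh0 : 0 < h := by positivity
  have hh1 : h ≤ 1 := by rw [hh, div_le_one (by positivity)]; exact hn1
  set cf : ℤ → ℂ := fun k => 1 / b *
      ((∫ x in (0 : ℝ)..1, Complex.exp (-(2 * Real.pi * Complex.I * k / b) * x) * (u 0 x : ℂ)) +
        ∫ x in (1 : ℝ)..b, Complex.exp (-(2 * Real.pi * Complex.I * k / b) * x) * (v 0 x : ℂ))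
    with hcf
  -- Applied twice: `s = 1` yields summability of the coefficients, `s = 2 * h` the sharp bound from
  -- the Nyquist frequency on.
  have key : ∀ k : ℤ, k ≠ 0 → ∀ s : ℝ, 1 / |(k : ℝ)| ≤ s → h ≤ s →
      ‖cf k‖ ≤ D * A * s ^ (d - 1) * (1 / (k : ℝ) ^ 2) := by
    intro k hk s hqs hhs
    have hkR : 0 < |(k : ℝ)| := abs_pos.2 (by exact_mod_cast hk)
    set q : ℝ := 1 / |(k : ℝ)| with hq
    have hq0 : 0 < q := by positivity
    have hq2 : 1 / (k : ℝ) ^ 2 = q ^ 2 := by rw [hq, div_pow, one_pow, sq_abs]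
    set w : ℂ := -(2 * Real.pi * Complex.I * k / b) with hw
    have hw' : w = ((-(2 * Real.pi * k / b) : ℝ) : ℂ) * Complex.I := by
      rw [hw]; push_cast; ring
    have hwn : 1 / ‖w‖ = β * q := by
      rw [hw', norm_mul, Complex.norm_I, mul_one, Complex.norm_real, Real.norm_eq_abs, abs_neg,
        abs_div, abs_mul, abs_of_pos hb0, abs_of_pos Real.two_pi_pos, hβ, hq]
      field_simp
    have hw0 : w ≠ 0 := by
      intro h0
      rw [h0, norm_zero, div_zero] at hwn
      exact (mul_pos hβ0 hq0).ne hwn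
    have hre : w.re = 0 := by rw [hw']; simp
    have hper : Complex.exp (w * b) = 1 := by
      rw [Complex.exp_eq_one_iff]
      refine ⟨-k, ?_⟩
      have : (b : ℂ) ≠ 0 := by exact_mod_cast hb0.ne'
      rw [hw]; push_cast; field_simp
    have hpow : ∀ m ≤ d, ∀ y, 0 ≤ y → y / ‖w‖ ^ (m + 1) ≤ y * (B * q ^ (m + 1)) := by
      intro m hm y hy
      rw [div_eq_mul_one_div, ← one_div_pow, hwn, mul_pow]
      gcongr
      calc β ^ (m + 1) ≤ (1 + β) ^ (m + 1) := by gcongr; linarith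
        _ ≤ B := pow_le_pow_right₀ (by linarith) (by omega)
    have hmain := norm_integral_piecewise_le hb hu hv hw0 hre hper (d + 1) hAu hAv
    have hlast : A * b / ‖w‖ ^ (d + 1) ≤ A * b * B * (s ^ (d - 1) * q ^ 2) := by
      refine (hpow d le_rfl _ (by positivity)).trans ?_
      have := pow_mul_pow_le_of_le hq0.le hh0.le hqs hhs hd le_rfl
      rw [Nat.sub_self, pow_zero, mul_one] at this
      rw [← mul_assoc]
      gcongr
    have hsum : ∑ m ∈ Finset.range (d + 1),
        (|v m b - u m 0| + |u m 1 - v m 1|) / ‖w‖ ^ (m + 1) ≤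
        ∑ m ∈ Finset.range (d + 1), 2 * A * B * (s ^ (d - 1) * q ^ 2) := by
      refine Finset.sum_le_sum fun m hm => ?_
      have hmd : m ≤ d := Nat.lt_succ_iff.1 (Finset.mem_range.1 hm)
      have hs0 : 0 ≤ s := hh0.le.trans hhs
      rcases Nat.eq_zero_or_pos m with rfl | hm0
      · rw [huv1, hvu0]
        simp only [sub_self, abs_zero, add_zero, zero_div]
        positivity
      · refine (hpow m hmd _ (by positivity)).trans ?_
        calc _ ≤ (A * h ^ (d - m) + A * h ^ (d - m)) * (B * q ^ (m + 1)) := by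
              gcongr
              · exact hJ0 m hmd
              · exact hJ1 m hmd
          _ = 2 * A * B * (q ^ (m + 1) * h ^ (d - m)) := by ring
          _ ≤ _ := by
              gcongr 2 * A * B * ?_
              exact pow_mul_pow_le_of_le hq0.le hh0.le hqs hhs hm0 hmd
    rw [Finset.sum_const, Finset.card_range, nsmul_eq_mul] at hsum
    rw [hcf]
    dsimp only
    rw [norm_mul, hq2]
    have h1b : ‖(1 / b : ℂ)‖ = 1 / b := by
      rw [norm_div, norm_one, Complex.norm_real, Real.norm_of_nonneg hb0.le]
    rw [h1b]
    calc _ ≤ 1 / b * (((d + 1 : ℕ) : ℝ) * (2 * A * B * (s ^ (d - 1) * q ^ 2)) +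
          A * b * B * (s ^ (d - 1) * q ^ 2)) := by
          gcongr
          exact hmain.trans (add_le_add hsum hlast)
      _ = _ := by rw [hD]; push_cast; ring
  have hsummable : Summable cf := by
    refine Summable.of_norm_bounded_eventually (g := fun k : ℤ => D * A * (1 / (k : ℝ) ^ 2))
      ((Real.summable_one_div_int_pow.2 one_lt_two).mul_left _) ?_
    filter_upwards [(Set.finite_singleton (0 : ℤ)).compl_mem_cofinite] with k hk
    have hk0 : k ≠ 0 := hk
    have := key k hk0 1 ?_ hh1
    · simpa using this
    · rw [div_le_one (abs_pos.2 (by exact_mod_cast hk0))]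
      exact_mod_cast Int.one_le_abs hk0
  have hM2 : 1 / (M : ℝ) ≤ 2 * h := by
    have hM' : (0 : ℝ) < M := by exact_mod_cast hM
    rw [hh, div_le_iff₀ hM']
    have : (M : ℝ) = n * b / 2 := by linarith
    rw [this]
    field_simp
    linarith
  have hbig : ∀ k : ℤ, (M : ℤ) ≤ |k| →
      ‖cf k‖ ≤ D * A * (2 * h) ^ (d - 1) * (1 / (k : ℝ) ^ 2) := by
    intro k hk
    have hk0 : k ≠ 0 := by
      rintro rfl
      simp at hk; omega
    refine key k hk0 (2 * h) ?_ (by linarith)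
    refine le_trans ?_ hM2
    have hM' : (0 : ℝ) < M := by exact_mod_cast hM
    gcongr
    exact_mod_cast hk
  have hcu : ContinuousOn (u 0) (Set.Icc 0 1) := fun x hx => (hu 0 x hx).continuousWithinAt
  have hcv : ContinuousOn (v 0) (Set.Icc 1 b) := fun x hx => (hv 0 x hx).continuousWithinAt
  have hser : ∀ t ∈ Set.Ico 0 b, _ := fun t ht =>
    hasSum_fourier_piecewise hb hcu hcv huv1 hvu0 (cf := cf) (fun k => rfl) hsummable ht
  have hfin := abs_interpolation_sub_le hn hN hnb
    (F := fun x => if x ≤ 1 then u 0 x else v 0 x) (cf := cf)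
    (hser x ⟨hx.1, hx.2.trans_lt hb⟩) (fun j hj => hser _ ⟨by unfold node; positivity, ?_⟩) hbig
  · simp only [hx.2, if_true] at hfin
    refine hfin.trans ?_
    obtain ⟨e, rfl⟩ := Nat.exists_eq_add_of_le' hd
    rw [Nat.add_sub_cancel]
    calc 2 * (D * A * (2 * h) ^ e) * (4 / M) = 8 * (D * A * (2 * h) ^ e) * (1 / M) := by ring
      _ ≤ 8 * (D * A * (2 * h) ^ e) * (2 * h) := by gcongr
      _ = _ := by ring
  · unfold node
    rw [div_lt_iff₀ (by positivity), mul_comm, hnb]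
    have : j < 2 * M := by omega
    exact_mod_cast this

/-! ### Gram polynomials and their expansions -/

/-- The `l`-th Gram polynomial before normalization. -/
def gramAux (n d l : ℕ) : ℝ[X] :=
  X ^ l - ∑ k ∈ Finset.range l,
    C (innerL n d (fun x => x ^ l) (fun x => (gramL n d k).eval x)) * gramL n d k

theorem gramL_eq (n d l : ℕ) :
    gramL n d l = C (Real.sqrt (innerL n d (fun x => (gramAux n d l).eval x)
      (fun x => (gramAux n d l).eval x)))⁻¹ * gramAux n d l := by
  rw [gramL, gramAux, Finset.sum_range]

theorem natDegree_gramL_le (n d l : ℕ) : (gramL n d l).natDegree ≤ l := by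
  induction l using Nat.strong_induction_on with
  | _ l ih =>
    rw [gramL_eq]
    refine (natDegree_C_mul_le _ _).trans ?_
    refine (natDegree_sub_le _ _).trans (max_le (natDegree_X_pow_le l) ?_)
    refine natDegree_sum_le_of_forall_le _ _ fun k hk => ?_
    have hk := Finset.mem_range.1 hk
    exact (natDegree_C_mul_le _ _).trans ((ih k hk).trans hk.le)

theorem gramAux_ne_zero (n d l : ℕ) : gramAux n d l ≠ 0 := by
  have hdeg : (∑ k ∈ Finset.range l,
      C (innerL n d (fun x => x ^ l) (fun x => (gramL n d k).eval x)) * gramL n d k).coeff l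
      = 0 := by
    rw [finsetSum_coeff]
    refine Finset.sum_eq_zero fun k hk => coeff_eq_zero_of_natDegree_lt ?_
    exact ((natDegree_C_mul_le _ _).trans (natDegree_gramL_le n d k)).trans_lt
      (Finset.mem_range.1 hk)
  intro h
  have h1 : (gramAux n d l).coeff l = 1 := by
    rw [gramAux, coeff_sub, hdeg, coeff_X_pow, if_pos rfl, sub_zero]
  rw [h, coeff_zero] at h1
  exact zero_ne_one h1

theorem natDegree_gramAux_le (n d l : ℕ) : (gramAux n d l).natDegree ≤ l := by
  refine (natDegree_sub_le _ _).trans (max_le (natDegree_X_pow_le l) ?_)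
  refine natDegree_sum_le_of_forall_le _ _ fun k hk => ?_
  exact (natDegree_C_mul_le _ _).trans
    ((natDegree_gramL_le n d k).trans (Finset.mem_range.1 hk).le)

theorem node_injective {n : ℕ} (hn : 0 < n) : Function.Injective (node n) := by
  intro i j h
  have hn' : (n : ℝ) ≠ 0 := by exact_mod_cast hn.ne'
  unfold node at h
  rw [div_left_inj' hn'] at h
  exact_mod_cast h

/-- A nonzero polynomial of degree `< d` cannot vanish at `d` distinct nodes; hence the
normalization never divides by zero. -/
theorem innerL_self_pos {n d : ℕ} (hn : 0 < n) {q : ℝ[X]} (hq : q ≠ 0) (hdeg : q.natDegree < d) :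
    0 < innerL n d (fun x => q.eval x) (fun x => q.eval x) := by
  unfold innerL
  refine lt_of_le_of_ne (Finset.sum_nonneg fun j _ => mul_self_nonneg _) fun h => hq ?_
  have h0 := (Finset.sum_eq_zero_iff_of_nonneg fun j _ => mul_self_nonneg _).1 h.symm
  refine eq_zero_of_natDegree_lt_card_of_eval_eq_zero' q ((Finset.range d).image (node n)) ?_ ?_
  · intro x hx
    obtain ⟨j, hj, rfl⟩ := Finset.mem_image.1 hx
    exact mul_self_eq_zero.1 (h0 j hj)
  · rwa [Finset.card_image_of_injective _ (node_injective hn), Finset.card_range]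

theorem innerL_comm (n d : ℕ) (p q : ℝ → ℝ) : innerL n d p q = innerL n d q p := by
  simp only [innerL, mul_comm]

theorem innerL_const_mul (n d : ℕ) (a : ℝ) (p q : ℝ → ℝ) :
    innerL n d (fun x => a * p x) q = a * innerL n d p q := by
  simp only [innerL, Finset.mul_sum, mul_assoc]

theorem innerL_gramAux (n d l : ℕ) (g : ℝ → ℝ) :
    innerL n d (fun x => (gramAux n d l).eval x) g = innerL n d (fun x => x ^ l) g -
      ∑ k ∈ Finset.range l, innerL n d (fun x => x ^ l) (fun x => (gramL n d k).eval x) *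
        innerL n d (fun x => (gramL n d k).eval x) g := by
  unfold gramAux
  generalize (fun k => innerL n d (fun x => x ^ l) (fun x => (gramL n d k).eval x)) = a
  simp only [innerL, eval_sub, eval_pow, eval_X, eval_finsetSum, eval_mul, eval_C, sub_mul,
    Finset.sum_sub_distrib, Finset.mul_sum, Finset.sum_mul]
  congr 1
  rw [Finset.sum_comm]
  simp only [mul_assoc]

theorem gramL_orthonormal {n d : ℕ} (hn : 0 < n) {l : ℕ} (hl : l < d) :
    innerL n d (fun x => (gramL n d l).eval x) (fun x => (gramL n d l).eval x) = 1 ∧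
    ∀ k < l, innerL n d (fun x => (gramL n d l).eval x) (fun x => (gramL n d k).eval x) = 0 := by
  induction l using Nat.strong_induction_on with
  | _ l ih =>
    have hpos := innerL_self_pos hn (gramAux_ne_zero n d l)
      ((natDegree_gramAux_le n d l).trans_lt hl)
    have heval : ∀ x, (gramL n d l).eval x = (Real.sqrt (innerL n d
        (fun x => (gramAux n d l).eval x) (fun x => (gramAux n d l).eval x)))⁻¹ *
          (gramAux n d l).eval x := fun x => by rw [gramL_eq, eval_mul, eval_C]
    set S := innerL n d (fun x => (gramAux n d l).eval x) (fun x => (gramAux n d l).eval x)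
    refine ⟨?_, fun k hk => ?_⟩
    · simp only [heval]
      rw [innerL_const_mul, innerL_comm, innerL_const_mul]
      have := Real.mul_self_sqrt hpos.le
      have h0 := (Real.sqrt_pos.2 hpos).ne'
      change (Real.sqrt S)⁻¹ * ((Real.sqrt S)⁻¹ * S) = 1
      field_simp
      nlinarith
    · simp only [heval]
      rw [innerL_const_mul, innerL_gramAux, Finset.sum_eq_single k]
      · rw [(ih k hk (hk.trans hl)).1, mul_one, sub_self, mul_zero]
      · intro i hi hik
        have hi := Finset.mem_range.1 hi
        rcases lt_or_gt_of_ne hik with h | h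
        · rw [innerL_comm n d (fun x => (gramL n d i).eval x), (ih k hk (hk.trans hl)).2 i h,
            mul_zero]
        · rw [(ih i hi (hi.trans hl)).2 k h, mul_zero]
      · intro h
        exact absurd (Finset.mem_range.2 hk) h

/-- The square matrix of the values of the Gram polynomials at the nodes is orthogonal. -/
theorem sum_gramL_mul_gramL {n d : ℕ} (hn : 0 < n) {i j : ℕ} (hi : i < d) (hj : j < d) :
    ∑ l ∈ Finset.range d, (gramL n d l).eval (node n i) * (gramL n d l).eval (node n j) =
      if i = j then 1 else 0 := by
  set A : Matrix (Fin d) (Fin d) ℝ := fun l j => (gramL n d l).eval (node n j) with hA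
  have h1 : A * A.transpose = 1 := by
    ext l k
    rw [Matrix.mul_apply, Matrix.one_apply]
    have : ∑ j, A l j * A.transpose j k =
        innerL n d (fun x => (gramL n d l).eval x) (fun x => (gramL n d k).eval x) := by
      rw [innerL, Finset.sum_range]
      rfl
    rw [this]
    split_ifs with h
    · rw [h, (gramL_orthonormal hn k.2).1]
    · rcases lt_or_gt_of_ne (fun h' => h (Fin.ext h')) with h' | h'
      · rw [innerL_comm, (gramL_orthonormal hn k.2).2 _ h']
      · exact (gramL_orthonormal hn l.2).2 _ h'
  -- For a square matrix a right inverse is a left inverse, so orthonormal rows give orthonormal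
  -- columns.
  have h2 := congrArg (fun B : Matrix (Fin d) (Fin d) ℝ => B ⟨i, hi⟩ ⟨j, hj⟩)
    (mul_eq_one_comm.1 h1)
  rw [Matrix.mul_apply, Matrix.one_apply] at h2
  rw [Finset.sum_range]
  simpa [Fin.ext_iff] using h2

/-- The left Gram expansion of `f`. -/
def expansionL (n d : ℕ) (f : ℝ → ℝ) : ℝ[X] :=
  ∑ l ∈ Finset.range d, C (innerL n d f (fun y => (gramL n d l).eval y)) * gramL n d l

/-- The right Gram expansion of `f`. -/
def expansionR (n d : ℕ) (f : ℝ → ℝ) : ℝ[X] :=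
  ∑ l ∈ Finset.range d, C (innerR n d f (fun y => (gramR n d l).eval y)) * gramR n d l

theorem natDegree_gramR_le (n d l : ℕ) : (gramR n d l).natDegree ≤ l := by
  unfold gramR
  refine natDegree_comp_le.trans ?_
  have : (X - C 1 + C (((d : ℝ) - 1) / (n : ℝ)) : ℝ[X]).natDegree ≤ 1 := by compute_degree
  calc _ ≤ l * 1 := Nat.mul_le_mul (natDegree_gramL_le n d l) this
    _ = l := mul_one l

theorem degree_expansionL_lt {n d : ℕ} (f : ℝ → ℝ) : (expansionL n d f).degree < d := by
  refine (degree_sum_le _ _).trans_lt ((Finset.sup_lt_iff (WithBot.bot_lt_coe d)).2 fun l hl => ?_)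
  exact degree_le_natDegree.trans_lt (Nat.cast_lt.2 (((natDegree_C_mul_le _ _).trans
    (natDegree_gramL_le n d l)).trans_lt (Finset.mem_range.1 hl)))

theorem degree_expansionR_lt {n d : ℕ} (f : ℝ → ℝ) : (expansionR n d f).degree < d := by
  refine (degree_sum_le _ _).trans_lt ((Finset.sup_lt_iff (WithBot.bot_lt_coe d)).2 fun l hl => ?_)
  exact degree_le_natDegree.trans_lt (Nat.cast_lt.2 (((natDegree_C_mul_le _ _).trans
    (natDegree_gramR_le n d l)).trans_lt (Finset.mem_range.1 hl)))

theorem expansionL_eval_node {n d : ℕ} (hn : 0 < n) (f : ℝ → ℝ) {i : ℕ} (hi : i < d) :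
    (expansionL n d f).eval (node n i) = f (node n i) := by
  simp only [expansionL, eval_finsetSum, eval_mul, eval_C, innerL, Finset.sum_mul]
  rw [Finset.sum_comm]
  simp_rw [mul_assoc, ← Finset.mul_sum]
  rw [Finset.sum_eq_single i]
  · rw [sum_gramL_mul_gramL hn hi hi, if_pos rfl, mul_one]
  · intro j hj hne
    rw [sum_gramL_mul_gramL hn (Finset.mem_range.1 hj) hi, if_neg hne, mul_zero]
  · intro h
    exact absurd (Finset.mem_range.2 hi) h

/-- The substitution defining `gramR` carries the right nodes onto the left ones; counting from the
right end reverses the index. -/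
theorem gramR_eval {n d : ℕ} (hn : 0 < n) (l : ℕ) {i : ℕ} (hi : i < d) :
    (gramR n d l).eval (((n : ℝ) - i) / n) = (gramL n d l).eval (node n (d - 1 - i)) := by
  have hn' : (n : ℝ) ≠ 0 := by exact_mod_cast hn.ne'
  unfold gramR node
  rw [eval_comp, Nat.cast_sub (by omega), Nat.cast_sub (by omega)]
  congr 1
  simp
  field_simp
  ring

theorem expansionR_eval_node {n d : ℕ} (hn : 0 < n) (f : ℝ → ℝ) {i : ℕ} (hi : i < d) :
    (expansionR n d f).eval (((n : ℝ) - i) / n) = f (((n : ℝ) - i) / n) := by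
  simp only [expansionR, eval_finsetSum, eval_mul, eval_C, innerR, Finset.sum_mul]
  rw [Finset.sum_comm]
  simp_rw [mul_assoc, ← Finset.mul_sum]
  have key : ∀ j < d, ∑ l ∈ Finset.range d, (gramR n d l).eval (((n : ℝ) - j) / n) *
      (gramR n d l).eval (((n : ℝ) - i) / n) = if j = i then 1 else 0 := by
    intro j hj
    simp_rw [gramR_eval hn _ hi, gramR_eval hn _ hj]
    rw [sum_gramL_mul_gramL hn (by omega) (by omega)]
    congr 1
    apply propext; omega
  rw [Finset.sum_eq_single i]
  · rw [key i hi, if_pos rfl, mul_one]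
  · intro j hj hne
    rw [key j (Finset.mem_range.1 hj), if_neg hne, mul_zero]
  · intro h
    exact absurd (Finset.mem_range.2 hi) h

/-! ### Two-point Hermite polynomials and the extension -/

/-- The sum truncates the power series of `(1 - w)^(-(r+1))`. In the induction on `r`, one factor `1
- w` lowers the binomials by Pascal's rule, up to a multiple of `w ^ s`. -/
theorem pow_dvd_one_sub_pow_mul_sum_sub_one {R : Type*} [CommRing R] (w : R) (r s : ℕ) :
    w ^ s ∣ (1 - w) ^ (r + 1) * ∑ l ∈ Finset.range s, ((r + l).choose r : R) * w ^ l - 1 := by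
  induction r with
  | zero =>
    refine ⟨-1, ?_⟩
    have := mul_neg_geom_sum w s
    simp only [zero_add, Nat.choose_zero_right, Nat.cast_one, one_mul, pow_one]
    rw [this]; ring
  | succ r ih =>
    have key : ∀ s : ℕ, (1 - w) * ∑ l ∈ Finset.range s, ((r + 1 + l).choose (r + 1) : R) * w ^ l =
        ∑ l ∈ Finset.range s, ((r + l).choose r : R) * w ^ l -
          ((r + s).choose (r + 1) : R) * w ^ s := by
      intro s
      induction s with
      | zero => simp
      | succ s ihs =>
        have hch : ((r + 1 + s).choose (r + 1) : R) =
            (r + s).choose r + (r + s).choose (r + 1) := by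
          rw [show r + 1 + s = (r + s) + 1 by ring, Nat.choose_succ_succ]; push_cast; rfl
        rw [Finset.sum_range_succ, Finset.sum_range_succ, mul_add, ihs,
          show r + (s + 1) = r + 1 + s by ring, hch]
        ring
    rw [pow_succ, mul_assoc, key, mul_sub, sub_right_comm]
    exact dvd_sub ih (dvd_mul_of_dvd_right (dvd_mul_left _ _) _)

theorem eval_iterate_derivative_X_sub_C_pow (a : ℝ) (k m : ℕ) :
    (derivative^[k] ((X - C a) ^ m)).eval a = if k = m then (m.factorial : ℝ) else 0 := by
  rw [iterate_derivative_X_sub_pow]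
  split_ifs with h
  · subst h; simp [Nat.descFactorial_self]
  · rcases lt_or_gt_of_ne h with h | h
    · have : m - k ≠ 0 := by omega
      simp [this]
    · simp [Nat.descFactorial_eq_zero_iff_lt.2 h]

theorem eval_iterate_derivative_eq_zero_of_pow_dvd {a : ℝ} {s k : ℕ} {p : ℝ[X]}
    (h : (X - C a) ^ s ∣ p) (hk : k < s) : (derivative^[k] p).eval a = 0 := by
  have h1 := pow_sub_dvd_iterate_derivative_of_pow_dvd k h
  have h2 : (X - C a) ∣ derivative^[k] p := (dvd_pow_self _ (by omega)).trans h1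
  exact dvd_iff_isRoot.1 h2

/-- The polynomial whose values are given by `hermite`. -/
def hermitePoly (r m : ℕ) (u₁ u₂ : ℝ) : ℝ[X] :=
  C (1 / (m.factorial : ℝ)) * (X - C u₁) ^ m * (C (1 / (u₁ - u₂)) * (X - C u₂)) ^ (r + 1) *
    ∑ l ∈ Finset.range (r - m + 1), ((r + l).choose r : ℝ[X]) *
      (C (1 / (u₂ - u₁)) * (X - C u₁)) ^ l

theorem eval_hermitePoly (r m : ℕ) (u₁ u₂ u : ℝ) :
    (hermitePoly r m u₁ u₂).eval u = hermite r m u₁ u₂ u := by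
  simp only [hermitePoly, hermite, eval_mul, eval_C, eval_pow, eval_sub, eval_X, eval_finsetSum,
    eval_natCast, div_eq_inv_mul, mul_one]

theorem eval_iterate_derivative_hermitePoly_right {r m k : ℕ} (u₁ u₂ : ℝ) (hk : k ≤ r) :
    (derivative^[k] (hermitePoly r m u₁ u₂)).eval u₂ = 0 := by
  refine eval_iterate_derivative_eq_zero_of_pow_dvd (s := r + 1) ?_ (by omega)
  unfold hermitePoly
  rw [mul_pow]
  exact Dvd.dvd.mul_right (Dvd.dvd.mul_left (dvd_mul_left _ _) _) _

/-- With `w = (X - u₁) / (u₂ - u₁)` the factor vanishing at `u₂` is `1 - w`, so the truncated series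
makes the polynomial congruent to `(X - u₁)^m / m!` modulo `(X - u₁)^(r+1)`. -/
theorem eval_iterate_derivative_hermitePoly_left {r m k : ℕ} {u₁ u₂ : ℝ} (hu : u₁ ≠ u₂)
    (hm : m ≤ r) (hk : k ≤ r) :
    (derivative^[k] (hermitePoly r m u₁ u₂)).eval u₁ = if k = m then 1 else 0 := by
  set w : ℝ[X] := C (1 / (u₂ - u₁)) * (X - C u₁) with hw
  have h12 : u₁ - u₂ ≠ 0 := sub_ne_zero.2 hu
  have h21 : u₂ - u₁ ≠ 0 := sub_ne_zero.2 hu.symm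
  have h1w : C (1 / (u₁ - u₂)) * (X - C u₂) = 1 - w := by
    have h : (C (1 / (u₁ - u₂)) : ℝ[X]) = -C (1 / (u₂ - u₁)) := by
      rw [← C_neg]; congr 1; rw [← neg_sub u₂ u₁]; field_simp
    have h' : C (1 / (u₂ - u₁)) * (C u₂ - C u₁) = (1 : ℝ[X]) := by
      rw [← C_sub, ← C_mul, one_div_mul_cancel h21, C_1]
    rw [hw, h, ← h']; ring
  have hdvd : (X - C u₁) ^ (r + 1) ∣
      hermitePoly r m u₁ u₂ - C (1 / (m.factorial : ℝ)) * (X - C u₁) ^ m := by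
    unfold hermitePoly
    rw [h1w, mul_assoc, ← mul_sub_one, show r + 1 = m + (r - m + 1) by omega, pow_add]
    refine mul_dvd_mul (dvd_mul_left _ _) ?_
    rw [show m + (r - m + 1) = r + 1 by omega]
    refine Dvd.dvd.trans ?_ (pow_dvd_one_sub_pow_mul_sum_sub_one w r (r - m + 1))
    rw [hw, mul_pow]
    exact dvd_mul_left _ _
  have h0 := eval_iterate_derivative_eq_zero_of_pow_dvd hdvd (Nat.lt_succ_of_le hk)
  rw [iterate_derivative_sub, eval_sub, sub_eq_zero, iterate_derivative_C_mul, eval_mul, eval_C,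
    eval_iterate_derivative_X_sub_C_pow] at h0
  rw [h0]
  split_ifs
  · exact one_div_mul_cancel (by positivity)
  · exact mul_zero _

/-- The polynomial whose values are given by `extension`. -/
def extensionPoly (r : ℕ) (b : ℝ) (n d : ℕ) (f : ℝ → ℝ) : ℝ[X] :=
  (∑ m ∈ Finset.range d, C ((derivative^[m] (expansionL n d f)).eval 0) * hermitePoly r m b 1) +
    ∑ m ∈ Finset.range d, C ((derivative^[m] (expansionR n d f)).eval 1) * hermitePoly r m 1 b

/-- Derivatives of order above the degree vanish, so the inner sums extend to `range d` and can be
interchanged. The continuation thus depends only on the end-point derivatives of the whole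
expansion. -/
theorem sum_mul_sum_iterate_derivative {d : ℕ} (a : ℕ → ℝ) {p : ℕ → ℝ[X]}
    (hp : ∀ l, (p l).natDegree ≤ l) (x : ℝ) (H : ℕ → ℝ) :
    ∑ l ∈ Finset.range d, a l * ∑ m ∈ Finset.range (l + 1),
        (derivative^[m] (p l)).eval x * H m =
      ∑ m ∈ Finset.range d,
        (derivative^[m] (∑ l ∈ Finset.range d, C (a l) * p l)).eval x * H m := by
  have h1 : ∀ l ∈ Finset.range d, a l * ∑ m ∈ Finset.range (l + 1),
      (derivative^[m] (p l)).eval x * H m =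
      ∑ m ∈ Finset.range d, a l * ((derivative^[m] (p l)).eval x * H m) := by
    intro l hl
    have hl := Finset.mem_range.1 hl
    rw [Finset.mul_sum]
    refine Finset.sum_subset (fun m hm => ?_) fun m _ hm => ?_
    · rw [Finset.mem_range] at hm ⊢; omega
    · rw [iterate_derivative_eq_zero ((hp l).trans_lt ?_)]
      · simp
      · rw [Finset.mem_range] at hm; omega
  rw [Finset.sum_congr rfl h1, Finset.sum_comm]
  refine Finset.sum_congr rfl fun m _ => ?_
  rw [iterate_derivative_sum, eval_finsetSum, Finset.sum_mul]
  refine Finset.sum_congr rfl fun l _ => ?_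
  rw [iterate_derivative_C_mul, eval_mul, eval_C, mul_assoc]

theorem eval_extensionPoly (r : ℕ) (b : ℝ) (n d : ℕ) (f : ℝ → ℝ) (x : ℝ) :
    (extensionPoly r b n d f).eval x = extension r b n d f x := by
  simp only [extension, extL, extR]
  rw [sum_mul_sum_iterate_derivative _ (natDegree_gramL_le n d),
    sum_mul_sum_iterate_derivative _ (natDegree_gramR_le n d)]
  simp only [extensionPoly, eval_add, eval_finsetSum, eval_mul, eval_C, eval_hermitePoly]
  rfl

theorem iterate_derivative_extensionPoly (r : ℕ) (b : ℝ) (n d : ℕ) (f : ℝ → ℝ) (k : ℕ) (x : ℝ) :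
    (derivative^[k] (extensionPoly r b n d f)).eval x =
      (∑ m ∈ Finset.range d, (derivative^[m] (expansionL n d f)).eval 0 *
        (derivative^[k] (hermitePoly r m b 1)).eval x) +
      ∑ m ∈ Finset.range d, (derivative^[m] (expansionR n d f)).eval 1 *
        (derivative^[k] (hermitePoly r m 1 b)).eval x := by
  simp only [extensionPoly, iterate_map_add derivative, iterate_derivative_sum,
    iterate_derivative_C_mul, eval_add, eval_finsetSum, eval_mul, eval_C]

theorem eval_iterate_derivative_extensionPoly_right {r d k : ℕ} {b : ℝ} (hb : b ≠ 1)
    (hr : d ≤ r + 1) (hk : k < d) (n : ℕ) (f : ℝ → ℝ) :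
    (derivative^[k] (extensionPoly r b n d f)).eval b =
      (derivative^[k] (expansionL n d f)).eval 0 := by
  rw [iterate_derivative_extensionPoly]
  simp only [eval_iterate_derivative_hermitePoly_right 1 b (show k ≤ r by omega), mul_zero,
    Finset.sum_const_zero, add_zero]
  rw [Finset.sum_eq_single k]
  · rw [eval_iterate_derivative_hermitePoly_left hb (by omega) (by omega), if_pos rfl, mul_one]
  · intro m hm hne
    have := Finset.mem_range.1 hm
    rw [eval_iterate_derivative_hermitePoly_left hb (by omega) (by omega), if_neg hne.symm,
      mul_zero]
  · intro h
    exact absurd (Finset.mem_range.2 hk) h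

theorem eval_iterate_derivative_extensionPoly_left {r d k : ℕ} {b : ℝ} (hb : b ≠ 1)
    (hr : d ≤ r + 1) (hk : k < d) (n : ℕ) (f : ℝ → ℝ) :
    (derivative^[k] (extensionPoly r b n d f)).eval 1 =
      (derivative^[k] (expansionR n d f)).eval 1 := by
  rw [iterate_derivative_extensionPoly]
  simp only [eval_iterate_derivative_hermitePoly_right b 1 (show k ≤ r by omega), mul_zero,
    Finset.sum_const_zero, zero_add]
  rw [Finset.sum_eq_single k]
  · rw [eval_iterate_derivative_hermitePoly_left hb.symm (by omega) (by omega), if_pos rfl,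
      mul_one]
  · intro m hm hne
    have := Finset.mem_range.1 hm
    rw [eval_iterate_derivative_hermitePoly_left hb.symm (by omega) (by omega), if_neg hne.symm,
      mul_zero]
  · intro h
    exact absurd (Finset.mem_range.2 hk) h

/-! ### End-point derivatives of the interpolating polynomials -/

/-- A polynomial of degree less than `d` that is small at `d` equispaced points has small scaled
derivatives there. -/
theorem exists_scaled_derivative_bound (d : ℕ) :
    ∃ K : ℝ, 0 ≤ K ∧ ∀ Q : ℝ[X], Q.degree < d → ∀ a t ε : ℝ,
      (∀ j < d, |Q.eval (a + t * j)| ≤ ε) →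
      ∀ m < d, |t| ^ m * |(derivative^[m] Q).eval a| ≤ K * ε := by
  set ℓ : ℕ → ℝ[X] := Lagrange.basis (Finset.range d) (fun j : ℕ => (j : ℝ)) with hℓ
  refine ⟨∑ m ∈ Finset.range d, (m.factorial : ℝ) * ∑ j ∈ Finset.range d, |(ℓ j).coeff m|,
    Finset.sum_nonneg fun m _ => mul_nonneg (by positivity)
      (Finset.sum_nonneg fun j _ => abs_nonneg _), ?_⟩
  intro Q hQ a t ε hε m hm
  have hε0 : 0 ≤ ε := (abs_nonneg _).trans (hε m hm)
  -- After rescaling the nodes are `0, …, d - 1`, so the Lagrange basis, and with it the constant,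
  -- is independent of `a` and `t`. The `m`-th coefficient of `P` is `t ^ m * Q^(m)(a) / m!`.
  set P : ℝ[X] := (taylor a Q).comp (C t * X) with hP
  have hPeval : ∀ y, P.eval y = Q.eval (a + t * y) := by
    intro y
    rw [hP, eval_comp, taylor_eval, eval_mul, eval_C, eval_X, add_comm]
  have hPdeg : P.degree < d := by
    rw [← degree_taylor Q a, degree_lt_iff_coeff_zero] at hQ
    rw [degree_lt_iff_coeff_zero]
    intro i hi
    rw [hP, comp_C_mul_X_coeff, hQ i hi, zero_mul]
  have hcoeff : P.coeff m = ∑ j ∈ Finset.range d, Q.eval (a + t * j) * (ℓ j).coeff m := by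
    have h := Lagrange.eq_interpolate (s := Finset.range d) (v := fun j : ℕ => (j : ℝ)) (f := P)
      (Nat.cast_injective.injOn) (by rwa [Finset.card_range])
    rw [h, Lagrange.interpolate_apply, finsetSum_coeff]
    refine Finset.sum_congr rfl fun j _ => ?_
    rw [coeff_C_mul, hPeval]
  have hder : t ^ m * (derivative^[m] Q).eval a = m.factorial * P.coeff m := by
    rw [hP, comp_C_mul_X_coeff, taylor_coeff, ← factorial_smul_hasseDeriv]
    simp
    ring
  rw [← abs_pow, ← abs_mul, hder, abs_mul, hcoeff, Nat.abs_cast, Finset.sum_mul]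
  have hterm : (m.factorial : ℝ) * |∑ j ∈ Finset.range d, Q.eval (a + t * j) * (ℓ j).coeff m| ≤
      (m.factorial : ℝ) * (∑ j ∈ Finset.range d, |(ℓ j).coeff m|) * ε := by
    rw [mul_assoc, Finset.sum_mul]
    gcongr
    refine (Finset.abs_sum_le_sum_abs _ _).trans (Finset.sum_le_sum fun j hj => ?_)
    rw [abs_mul, mul_comm]
    gcongr
    exact hε j (Finset.mem_range.1 hj)
  refine hterm.trans ?_
  exact Finset.single_le_sum
    (f := fun m => (m.factorial : ℝ) * (∑ j ∈ Finset.range d, |(ℓ j).coeff m|) * ε)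
    (fun i _ => mul_nonneg (mul_nonneg (by positivity)
      (Finset.sum_nonneg fun j _ => abs_nonneg _)) hε0) (Finset.mem_range.2 hm)

/-- The Taylor polynomial of degree less than `d` at `a` with the derivatives `u m a`. -/
def jetPoly (u : ℕ → ℝ → ℝ) (a : ℝ) (d : ℕ) : ℝ[X] :=
  ∑ m ∈ Finset.range d, C (u m a / (m.factorial : ℝ)) * (X - C a) ^ m

theorem eval_iterate_derivative_jetPoly (u : ℕ → ℝ → ℝ) (a : ℝ) {d k : ℕ} (hk : k < d) :
    (derivative^[k] (jetPoly u a d)).eval a = u k a := by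
  unfold jetPoly
  rw [iterate_derivative_sum, eval_finsetSum, Finset.sum_eq_single k]
  · rw [iterate_derivative_C_mul, eval_mul, eval_C, eval_iterate_derivative_X_sub_C_pow,
      if_pos rfl]
    field_simp
  · intro m _ hne
    rw [iterate_derivative_C_mul, eval_mul, eval_C, eval_iterate_derivative_X_sub_C_pow,
      if_neg hne.symm, mul_zero]
  · intro h
    exact absurd (Finset.mem_range.2 hk) h

theorem degree_jetPoly_lt (u : ℕ → ℝ → ℝ) (a : ℝ) (d : ℕ) : (jetPoly u a d).degree < d := by
  refine (degree_sum_le _ _).trans_lt ((Finset.sup_lt_iff (WithBot.bot_lt_coe d)).2 fun l hl => ?_)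
  refine degree_le_natDegree.trans_lt (Nat.cast_lt.2 ?_)
  refine ((natDegree_C_mul_le _ _).trans ?_).trans_lt (Finset.mem_range.1 hl)
  rw [natDegree_pow, natDegree_X_sub_C, mul_one]

theorem derivative_jetPoly (u : ℕ → ℝ → ℝ) (a : ℝ) (d : ℕ) :
    derivative (jetPoly u a (d + 1)) = jetPoly (fun m => u (m + 1)) a d := by
  unfold jetPoly
  rw [Finset.sum_range_succ', derivative_add, derivative_sum]
  simp only [pow_zero, mul_one, derivative_C, add_zero]
  refine Finset.sum_congr rfl fun m _ => ?_
  rw [derivative_C_mul, derivative_X_sub_C_pow, Nat.add_sub_cancel, ← mul_assoc, ← C_mul]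
  congr 2
  rw [Nat.factorial_succ]
  push_cast
  field_simp

/-- Induction on `d`: the derivative of the Taylor error is the error of order one less for the
shifted sequence, and the mean value inequality adds a factor `|x - a|`. The factorial gain is not
needed. -/
theorem abs_sub_jetPoly_le {s : Set ℝ} (hs : Convex ℝ s) {B : ℝ} (d : ℕ) {u : ℕ → ℝ → ℝ}
    (hu : ∀ m, ∀ x ∈ s, HasDerivWithinAt (u m) (u (m + 1) x) s x)
    (hB : ∀ x ∈ s, |u d x| ≤ B) {a x : ℝ} (ha : a ∈ s) (hx : x ∈ s) :
    |u 0 x - (jetPoly u a d).eval x| ≤ B * |x - a| ^ d := by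
  induction d generalizing u x with
  | zero => simpa [jetPoly] using hB x hx
  | succ d ih =>
    have hB0 : 0 ≤ B := (abs_nonneg _).trans (hB a ha)
    have hsub : Set.uIcc a x ⊆ s := hs.ordConnected.uIcc_subset ha hx
    have hder : ∀ y ∈ Set.uIcc a x, HasDerivWithinAt
        (fun y => u 0 y - (jetPoly u a (d + 1)).eval y)
        (u 1 y - (jetPoly (fun m => u (m + 1)) a d).eval y) (Set.uIcc a x) y := by
      intro y hy
      refine ((hu 0 y (hsub hy)).mono hsub).sub ?_
      rw [← derivative_jetPoly]
      exact (Polynomial.hasDerivAt _ y).hasDerivWithinAt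
    have hbd : ∀ y ∈ Set.uIcc a x,
        ‖u 1 y - (jetPoly (fun m => u (m + 1)) a d).eval y‖ ≤ B * |x - a| ^ d := by
      intro y hy
      refine (ih (u := fun m => u (m + 1)) (fun m => hu (m + 1)) hB (hsub hy)).trans ?_
      have : |y - a| ≤ |x - a| := Set.abs_sub_left_of_mem_uIcc hy
      gcongr
    have h := Convex.norm_image_sub_le_of_norm_hasDerivWithin_le hder hbd (convex_uIcc a x)
      Set.left_mem_uIcc Set.right_mem_uIcc
    have ha0 : (jetPoly u a (d + 1)).eval a = u 0 a :=
      eval_iterate_derivative_jetPoly u a (Nat.succ_pos d)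
    simp only [ha0, sub_self, sub_zero, Real.norm_eq_abs] at h
    rwa [mul_assoc, ← pow_succ] at h

theorem hasDerivWithinAt_iteratedDerivWithin {f : ℝ → ℝ} {s : Set ℝ} (hs : UniqueDiffOn ℝ s)
    (hf : ContDiffOn ℝ ((⊤ : ℕ∞) : WithTop ℕ∞) f s) (m : ℕ) {x : ℝ} (hx : x ∈ s) :
    HasDerivWithinAt (iteratedDerivWithin m f s) (iteratedDerivWithin (m + 1) f s x) s x := by
  rw [iteratedDerivWithin_succ]
  exact ((hf.differentiableOn_iteratedDerivWithin (by exact_mod_cast ENat.natCast_lt_top m) hs)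
    x hx).hasDerivWithinAt

theorem exists_abs_le_of_continuousOn_Icc {g : ℝ → ℝ} {a c : ℝ}
    (hg : ContinuousOn g (Set.Icc a c)) : ∃ B : ℝ, 0 ≤ B ∧ ∀ x ∈ Set.Icc a c, |g x| ≤ B := by
  obtain ⟨B, hB⟩ := isCompact_Icc.exists_bound_of_continuousOn hg
  exact ⟨max B 0, le_max_right _ _, fun x hx => (hB x hx).trans (le_max_left _ _)⟩

/-- The derivatives at the end point of the polynomial interpolating `u 0` at `d` equispaced points
approximate those of `u 0`. -/
theorem abs_iterate_derivative_sub_le {d : ℕ} {K : ℝ}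
    (hK : ∀ Q : ℝ[X], Q.degree < d → ∀ a t ε : ℝ, (∀ j < d, |Q.eval (a + t * j)| ≤ ε) →
      ∀ m < d, |t| ^ m * |(derivative^[m] Q).eval a| ≤ K * ε)
    {s : Set ℝ} (hs : Convex ℝ s) {u : ℕ → ℝ → ℝ}
    (hu : ∀ m, ∀ x ∈ s, HasDerivWithinAt (u m) (u (m + 1) x) s x)
    {B : ℝ} (hB : ∀ x ∈ s, |u d x| ≤ B) {a t : ℝ} (ha : a ∈ s) (ht : t ≠ 0)
    (hmem : ∀ j < d, a + t * (j : ℕ) ∈ s) {T : ℝ[X]} (hT : T.degree < d)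
    (hval : ∀ j < d, T.eval (a + t * (j : ℕ)) = u 0 (a + t * (j : ℕ))) {m : ℕ} (hm : m < d) :
    |(derivative^[m] T).eval a - u m a| ≤ K * (B * (d : ℝ) ^ d) * |t| ^ (d - m) := by
  have hB0 : 0 ≤ B := (abs_nonneg _).trans (hB a ha)
  have hQ : (T - jetPoly u a d).degree < d :=
    (degree_sub_le _ _).trans_lt (max_lt hT (degree_jetPoly_lt u a d))
  -- At the nodes `T - jetPoly u a d` equals the Taylor remainder of `u 0`, at most `B * (d * |t|) ^
  -- d`. Passing to the `m`-th derivative costs `|t| ^ m`.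
  have h := hK _ hQ a t (B * (d : ℝ) ^ d * |t| ^ d) ?_ m hm
  · rw [iterate_derivative_sub, eval_sub, eval_iterate_derivative_jetPoly u a hm] at h
    have ht0 : 0 < |t| ^ m := by positivity
    rw [← mul_le_mul_iff_right₀ ht0]
    refine h.trans (le_of_eq ?_)
    have : |t| ^ d = |t| ^ m * |t| ^ (d - m) := by
      rw [← pow_add]; congr 1; omega
    rw [this]; ring
  · intro j hj
    rw [eval_sub, hval j hj]
    refine (abs_sub_jetPoly_le hs d hu hB ha (hmem j hj)).trans ?_
    rw [add_sub_cancel_left, abs_mul, mul_pow, Nat.abs_cast, mul_comm (|t| ^ d), ← mul_assoc]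
    have : (j : ℝ) ≤ d := by exact_mod_cast hj.le
    gcongr

theorem exists_expansion_jet_bound {d : ℕ} {u : ℕ → ℝ → ℝ}
    (hu : ∀ m, ∀ x ∈ Set.Icc (0 : ℝ) 1, HasDerivWithinAt (u m) (u (m + 1) x) (Set.Icc 0 1) x) :
    ∃ A : ℝ, 0 ≤ A ∧ ∀ n : ℕ, 0 < n → d ≤ n → ∀ m < d,
      |(derivative^[m] (expansionL n d (u 0))).eval 0 - u m 0| ≤ A * (1 / (n : ℝ)) ^ (d - m) ∧
      |(derivative^[m] (expansionR n d (u 0))).eval 1 - u m 1| ≤ A * (1 / (n : ℝ)) ^ (d - m) := by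
  obtain ⟨K, hK0, hK⟩ := exists_scaled_derivative_bound d
  obtain ⟨B, hB0, hB⟩ := exists_abs_le_of_continuousOn_Icc (g := u d)
    (fun x hx => (hu d x hx).continuousWithinAt)
  refine ⟨K * (B * (d : ℝ) ^ d), by positivity, fun n hn hdn m hm => ?_⟩
  have hn' : (0 : ℝ) < n := by exact_mod_cast hn
  have habs : |1 / (n : ℝ)| = 1 / n := abs_of_pos (by positivity)
  have hL : ∀ j : ℕ, 0 + 1 / (n : ℝ) * j = node n j := fun j => by unfold node; ring
  have hR : ∀ j : ℕ, 1 + -(1 / (n : ℝ)) * j = ((n : ℝ) - j) / n := fun j => by field_simp; ring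
  have hjn : ∀ j < d, (j : ℝ) / n ≤ 1 := fun j hj => by
    rw [div_le_one hn']; exact_mod_cast hj.le.trans hdn
  constructor
  · have h := abs_iterate_derivative_sub_le hK (convex_Icc 0 1) hu hB
      (a := 0) (t := 1 / (n : ℝ)) (by simp) (by positivity) (fun j hj => ?_)
      (degree_expansionL_lt (n := n) (u 0)) (fun j hj => ?_) hm
    · rwa [habs] at h
    · rw [hL]
      exact ⟨by unfold node; positivity, hjn j hj⟩
    · rw [hL, expansionL_eval_node hn _ hj]
  · have h := abs_iterate_derivative_sub_le hK (convex_Icc 0 1) hu hB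
      (a := 1) (t := -(1 / (n : ℝ))) (by simp) (by simp [hn.ne']) (fun j hj => ?_)
      (degree_expansionR_lt (n := n) (u 0)) (fun j hj => ?_) hm
    · rwa [abs_neg, habs] at h
    · rw [hR, sub_div, div_self hn'.ne']
      exact ⟨by linarith [hjn j hj], by linarith [show 0 ≤ (j : ℝ) / n by positivity]⟩
    · rw [hR, expansionR_eval_node hn _ hj]

theorem exists_sum_mul_eval_bound {ι : Type*} (s : Finset ι) (H : ι → ℝ[X]) (a c : ℝ)
    (w : ι → ℝ) :
    ∃ V : ℝ, 0 ≤ V ∧ ∀ e : ι → ℝ, (∀ i ∈ s, |e i| ≤ w i) →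
      ∀ x ∈ Set.Icc a c, |∑ i ∈ s, e i * (H i).eval x| ≤ V := by
  choose B hB0 hB using fun i => exists_abs_le_of_continuousOn_Icc (g := fun x => (H i).eval x)
    (a := a) (c := c) (H i).continuous.continuousOn
  refine ⟨∑ i ∈ s, |w i| * B i,
    Finset.sum_nonneg fun i _ => mul_nonneg (abs_nonneg _) (hB0 i), fun e he x hx => ?_⟩
  refine (Finset.abs_sum_le_sum_abs _ _).trans (Finset.sum_le_sum fun i hi => ?_)
  rw [abs_mul]
  exact mul_le_mul ((he i hi).trans (le_abs_self _)) (hB i x hx) (abs_nonneg _) (abs_nonneg _)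

/-- The Hermite polynomials do not depend on `n`, and their coefficients stay within `A` of the
derivatives of `u 0` at the end points, so the bound is uniform in `n`. -/
theorem exists_extensionPoly_bound (r : ℕ) (b : ℝ) {d : ℕ} {u : ℕ → ℝ → ℝ}
    (hu : ∀ m, ∀ x ∈ Set.Icc (0 : ℝ) 1, HasDerivWithinAt (u m) (u (m + 1) x) (Set.Icc 0 1) x)
    (k : ℕ) :
    ∃ V : ℝ, 0 ≤ V ∧ ∀ n : ℕ, 0 < n → d ≤ n → ∀ x ∈ Set.Icc 1 b,
      |(derivative^[k] (extensionPoly r b n d (u 0))).eval x| ≤ V := by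
  obtain ⟨A, hA0, hA⟩ := exists_expansion_jet_bound (d := d) hu
  obtain ⟨V₁, h10, h1⟩ := exists_sum_mul_eval_bound (Finset.range d)
    (fun m => derivative^[k] (hermitePoly r m b 1)) 1 b (fun m => A + |u m 0|)
  obtain ⟨V₂, h20, h2⟩ := exists_sum_mul_eval_bound (Finset.range d)
    (fun m => derivative^[k] (hermitePoly r m 1 b)) 1 b (fun m => A + |u m 1|)
  refine ⟨V₁ + V₂, by positivity, fun n hn hdn x hx => ?_⟩
  have hn1 : (1 : ℝ) ≤ n := by exact_mod_cast hn
  have hpow : ∀ e : ℕ, A * (1 / (n : ℝ)) ^ e ≤ A := fun e =>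
    mul_le_of_le_one_right hA0 (pow_le_one₀ (by positivity) (by rwa [div_le_one (by positivity)]))
  rw [iterate_derivative_extensionPoly]
  refine (abs_add_le _ _).trans (add_le_add (h1 _ (fun m hm => ?_) x hx)
    (h2 _ (fun m hm => ?_) x hx))
  · have h := ((hA n hn hdn m (Finset.mem_range.1 hm)).1).trans (hpow _)
    have := abs_sub_abs_le_abs_sub ((derivative^[m] (expansionL n d (u 0))).eval 0) (u m 0)
    linarith
  · have h := ((hA n hn hdn m (Finset.mem_range.1 hm)).2).trans (hpow _)
    have := abs_sub_abs_le_abs_sub ((derivative^[m] (expansionR n d (u 0))).eval 1) (u m 1)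
    linarith

/-! ### Error bounds for the FC-Gram interpolant -/

theorem tau_eq {b : ℚ} (hb : 1 < b) {n : ℕ} (hn : n ∈ admissible b) :
    0 < n ∧ ∃ c M : ℕ, n + c + 1 = 2 * M ∧ (n : ℝ) * (b : ℝ) = 2 * M ∧
      ∀ (r d : ℕ) (f : ℝ → ℝ) (x : ℝ), tau r d b n f x = ∑ j ∈ Finset.range (n + c + 1),
        continued r b n d f (node n j) * cardinal n c j x := by
  obtain ⟨hn0, k, hk, M, rfl⟩ := hn
  have hlt : n < 2 * M := by
    have h1 : (n : ℚ) < n * b := lt_mul_of_one_lt_right (by exact_mod_cast hn0) hb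
    rw [hk] at h1
    exact_mod_cast h1
  have hN : n + (2 * M - n - 1) + 1 = 2 * M := by omega
  have hnb : (n : ℝ) * (b : ℝ) = 2 * M := by exact_mod_cast hk
  refine ⟨hn0, 2 * M - n - 1, M, hN, hnb, fun r d f x => ?_⟩
  have hn' : (n : ℝ) ≠ 0 := by exact_mod_cast hn0.ne'
  have hper : 1 + (((2 * M - n - 1 : ℕ) : ℝ) + 1) / (n : ℝ) = b := by
    have : (n : ℝ) + ((2 * M - n - 1 : ℕ) : ℝ) + 1 = 2 * M := by exact_mod_cast hN
    field_simp
    linarith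
  rw [tau, hk, Nat.floor_natCast, interpolant, hper]

theorem exists_tau_sub_bound {d : ℕ} (hd : 1 ≤ d) {r : ℕ} (hr : d ≤ r + 1) {b : ℚ} (hb : 1 < b)
    {f : ℝ → ℝ} (hf : ContDiffOn ℝ ((⊤ : ℕ∞) : WithTop ℕ∞) f (Set.Icc 0 1)) :
    ∃ C : ℝ, 0 ≤ C ∧ ∀ n ∈ admissible b, d ≤ n → ∀ x ∈ Set.Icc (0 : ℝ) 1,
      |tau r d b n f x - f x| ≤ C * (1 / (n : ℝ)) ^ d := by
  have hbR : (1 : ℝ) < b := by exact_mod_cast hb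
  obtain ⟨u, hu0, hu⟩ : ∃ u : ℕ → ℝ → ℝ, u 0 = f ∧ ∀ m, ∀ x ∈ Set.Icc (0 : ℝ) 1,
      HasDerivWithinAt (u m) (u (m + 1) x) (Set.Icc 0 1) x :=
    ⟨fun m => iteratedDerivWithin m f (Set.Icc 0 1), iteratedDerivWithin_zero, fun m x hx =>
      hasDerivWithinAt_iteratedDerivWithin (uniqueDiffOn_Icc zero_lt_one) hf m hx⟩
  subst hu0
  obtain ⟨A, hA0, hA⟩ := exists_expansion_jet_bound (d := d) hu
  have hubd : ∀ m, ∃ U : ℝ, 0 ≤ U ∧ ∀ x ∈ Set.Icc (0 : ℝ) 1, |u m x| ≤ U := fun m =>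
    exists_abs_le_of_continuousOn_Icc (fun x hx => (hu m x hx).continuousWithinAt)
  obtain ⟨U₀, hU00, hU0⟩ := hubd d
  obtain ⟨U₁, hU10, hU1⟩ := hubd (d + 1)
  obtain ⟨V₀, hV00, hV0⟩ := exists_extensionPoly_bound r b (d := d) hu d
  obtain ⟨V₁, hV10, hV1⟩ := exists_extensionPoly_bound r b (d := d) hu (d + 1)
  obtain ⟨C, hC0, hC⟩ := exists_interpolation_bound hbR hd
  -- The summands serve, in order, the jumps of order `< d`, the jump of order `d`, and the
  -- derivatives of order `d + 1` in the remainder integral.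
  set A' : ℝ := A + (U₀ + V₀) + (U₁ + V₁) with hA'
  refine ⟨C * A', by positivity, fun n hn hdn x hx => ?_⟩
  obtain ⟨hn0, c, M, hN, hnb, htau⟩ := tau_eq hb hn
  have h0 : (0 : ℝ) ∈ Set.Icc (0 : ℝ) 1 := by simp
  have h1 : (1 : ℝ) ∈ Set.Icc (0 : ℝ) 1 := by simp
  have h1b : (1 : ℝ) ∈ Set.Icc (1 : ℝ) b := ⟨le_rfl, hbR.le⟩
  have hbb : (b : ℝ) ∈ Set.Icc (1 : ℝ) b := ⟨hbR.le, le_rfl⟩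
  have hpow : ∀ e : ℕ, A * (1 / (n : ℝ)) ^ e ≤ A' * (1 / (n : ℝ)) ^ e := fun e => by
    gcongr; rw [hA']; linarith
  set v : ℕ → ℝ → ℝ := fun m x => (derivative^[m] (extensionPoly r b n d (u 0))).eval x with hv
  have hvL : ∀ m < d, v m b = (derivative^[m] (expansionL n d (u 0))).eval 0 := fun m hm =>
    eval_iterate_derivative_extensionPoly_right hbR.ne' hr hm n (u 0)
  have hvR : ∀ m < d, v m 1 = (derivative^[m] (expansionR n d (u 0))).eval 1 := fun m hm =>
    eval_iterate_derivative_extensionPoly_left hbR.ne' hr hm n (u 0)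
  have hfin := hC n c M hn0 hN hnb u v hu (fun m x _ => ?_) ?_ ?_ A' (fun m hm => ?_)
    (fun m hm => ?_) (fun x hx => ?_) (fun x hx => ?_) x hx
  · rw [htau]
    convert hfin using 6
    simp only [continued, hv, Function.iterate_zero, id_eq, eval_extensionPoly]
  · simp only [hv, Function.iterate_succ_apply']
    exact (Polynomial.hasDerivAt _ x).hasDerivWithinAt
  -- The end point `1` is itself an interpolation node, so the gluing there is exact.
  · have h := expansionR_eval_node (d := d) hn0 (u 0) (i := 0) (by omega)
    have hn' : (n : ℝ) ≠ 0 := by exact_mod_cast hn0.ne'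
    rw [Nat.cast_zero, sub_zero, div_self hn'] at h
    rw [hvR 0 (by omega)]
    exact h.symm
  · have h := expansionL_eval_node (d := d) hn0 (u 0) (i := 0) (by omega)
    rw [node, Nat.cast_zero, zero_div] at h
    rw [hvL 0 (by omega)]
    exact h
  -- Below order `d` the jump is an interpolation error; at order `d` the power of `h` is `1`, so
  -- boundedness suffices.
  · rcases hm.lt_or_eq with hlt | rfl
    · rw [hvL m hlt]
      exact ((hA n hn0 hdn m hlt).1).trans (hpow _)
    · rw [Nat.sub_self, pow_zero, mul_one]
      have := abs_sub (v m b) (u m 0)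
      linarith [hV0 n hn0 hdn b hbb, hU0 0 h0]
  · rcases hm.lt_or_eq with hlt | rfl
    · rw [hvR m hlt, abs_sub_comm]
      exact ((hA n hn0 hdn m hlt).2).trans (hpow _)
    · rw [Nat.sub_self, pow_zero, mul_one]
      have := abs_sub (u m 1) (v m 1)
      linarith [hV0 n hn0 hdn 1 h1b, hU0 1 h1]
  · linarith [hU1 x hx]
  · linarith [hV1 n hn0 hdn x hx]

/-- Covers each `n < d`, where nodes of the inner products may leave `[0, 1]`. Only `|L_j| ≤ 1` and
the boundedness of `f` on `[0, 1]` are used. -/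
theorem exists_tau_sub_bound_of_fixed {b : ℚ} (hb : 1 < b) {f : ℝ → ℝ}
    (hf : ContinuousOn f (Set.Icc 0 1)) (r d n : ℕ) :
    ∃ B : ℝ, 0 ≤ B ∧ (n ∈ admissible b → ∀ x ∈ Set.Icc (0 : ℝ) 1, |tau r d b n f x - f x| ≤ B) := by
  by_cases hn : n ∈ admissible b
  · obtain ⟨-, c, M, hN, -, htau⟩ := tau_eq hb hn
    obtain ⟨B, hB0, hB⟩ := exists_abs_le_of_continuousOn_Icc hf
    refine ⟨∑ j ∈ Finset.range (n + c + 1), |continued r b n d f (node n j)| + B,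
      add_nonneg (Finset.sum_nonneg fun j _ => abs_nonneg _) hB0, fun _ x hx => ?_⟩
    refine (abs_sub _ _).trans (add_le_add ?_ (hB x hx))
    rw [htau]
    refine (Finset.abs_sum_le_sum_abs _ _).trans (Finset.sum_le_sum fun j _ => ?_)
    rw [abs_mul]
    exact mul_le_of_le_one_right (abs_nonneg _) (abs_cardinal_le_one hN j x)
  · exact ⟨0, le_rfl, fun h => absurd h hn⟩

end FCGram

end

theorem theorem1 (d : ℕ) (hd : 1 ≤ d) (r : ℕ) (hr : d ≤ r + 1) (b : ℚ) (hb : 1 < b)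
    (f : ℝ → ℝ) (hf : ContDiffOn ℝ ((⊤ : ℕ∞) : WithTop ℕ∞) f (Set.Icc 0 1)) :
    ∃ M : ℝ, 0 < M ∧ ∀ n ∈ FCGram.admissible b, ∀ x ∈ Set.Icc (0 : ℝ) 1,
      |FCGram.tau r d b n f x - f x| ≤ M * (n : ℝ) ^ (-(d : ℤ)) := by
  obtain ⟨C, hC0, hC⟩ := FCGram.exists_tau_sub_bound hd hr hb hf
  choose B hB0 hB using FCGram.exists_tau_sub_bound_of_fixed hb hf.continuousOn r d
  have hS0 : 0 ≤ ∑ n ∈ Finset.range d, B n * (n : ℝ) ^ d :=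
    Finset.sum_nonneg fun n _ => mul_nonneg (hB0 n) (by positivity)
  -- The term `B n * n ^ d` absorbs the exceptional `n`; the final `1` only ensures positivity.
  refine ⟨C + ∑ n ∈ Finset.range d, B n * (n : ℝ) ^ d + 1, by positivity, fun n hn x hx => ?_⟩
  have hn' : (0 : ℝ) < n := by exact_mod_cast hn.1
  rw [zpow_neg, zpow_natCast, ← one_div, ← one_div_pow]
  rcases le_or_gt d n with h | h
  · refine (hC n hn h x hx).trans ?_
    gcongr
    linarith
  · refine (hB n hn x hx).trans ?_
    have h1 : B n * (n : ℝ) ^ d ≤ ∑ n ∈ Finset.range d, B n * (n : ℝ) ^ d :=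
      Finset.single_le_sum (f := fun n => B n * (n : ℝ) ^ d)
        (fun n _ => mul_nonneg (hB0 n) (by positivity)) (Finset.mem_range.2 h)
    calc B n = B n * (n : ℝ) ^ d * (1 / (n : ℝ)) ^ d := by
          rw [mul_assoc, ← mul_pow, mul_one_div_cancel hn'.ne', one_pow, mul_one]
      _ ≤ _ := by
          gcongr
          linarith
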